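/- Let $D=(0,\infty)$ carry the measure $\gamma(dy)=(1-e^{-y^2})\,dy$, let $g_1(s,x)=(2\pi s)^{-1/2}e^{-x^2/(2s)}$, and for $s,x,y>0$ put $$p_s(x,y)=g_1(s,y-x)-g_1(s,y+x),\qquad k_s(y)=\tfrac12\,\partial_x p_s(x,y)\big|_{x=0^+}=\frac{y\,g_1(s,y)}{s}.$$ Let $T_tf(x)=\int_D p_t(x,y)f(y)\,dy$ $(t>0)$ be the transition semigroup of absorbing-barrier Brownian motion in $D$, acting on the real Hilbert space $L^2(D,\gamma)$. An entrance path is a family $\tilde x=(\tilde x(s))_{s>0}$ in $L^2(D,\gamma)$ with $\tilde x(r+t)=T_t\tilde x(r)$ for all $r,t>0$; the entrance space $\tilde L^2(D,\gamma)$ is the set of entrance paths with $\int_0^l\|\tilde x(s)\|^2ds<\infty$ for some $l>0$, and $\tilde L^2_+(D,\gamma)$ is the set of those $\tilde x\in\tilde L^2(D,\gamma)$ with $\tilde x(s)\ge 0$ $\gamma$-almost everywhere for every $s>0$. Let $S_+(D,\gamma)$ be the set of non-negative (possibly infinite) Borel measures $\mu$ on $D$ such that, for some $l>0$, $$\int_0^l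 ds\int_D\Big(\int_D p_s(x,y)\,\mu(dx)\Big)^2\gamma(dy)<\infty .$$ **Theorem 5.2.** There is a one-to-one correspondence between $\tilde x\in\tilde L^2_+(D,\gamma)$ and $(a,\mu)\in[0,\infty)\times S_+(D,\gamma)$, given by $$\tilde x(s,\cdot)=a\,k_s(\cdot)+\int_D p_s(z,\cdot)\,\mu(dz)\quad\text{in }L^2(D,\gamma),\qquad s>0,$$ where the integral $\int_D p_s(z,y)\,\mu(dz)$ is finite for all $s,y>0$. -/

import Mathlib

open MeasureTheory

noncomputable section

namespace AbsorbingBM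

/-- The half-line `D = (0,∞)`, with its Borel σ-algebra (inherited from `ℝ`). It serves both as state space and as the set of positive times. -/
abbrev HalfLine : Type := {x : ℝ // 0 < x}

/-- Lebesgue measure on `(0,∞)`. -/
def leb : Measure HalfLine := (volume : Measure ℝ).comap Subtype.val

/-- The one-dimensional heat kernel `g₁(s,x) = (2πs)^{-1/2} exp(-x²/(2s))`. -/
def heatKernel (s x : ℝ) : ℝ :=
  (Real.sqrt (2 * Real.pi * s))⁻¹ * Real.exp (-x ^ 2 / (2 * s))

/-- The transition density of Brownian motion on `(0,∞)` absorbed at `0`. -/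
def transitionDensity (s x y : ℝ) : ℝ :=
  heatKernel s (y - x) - heatKernel s (y + x)

/-- `k_s(y) = y g₁(s,y) / s`, which is one half of `∂ₓ p_s(x,y)` at `x = 0`. -/
def boundaryKernel (s y : ℝ) : ℝ :=
  y * heatKernel s y / s

theorem hasDerivAt_transitionDensity_zero {s : ℝ} (hs : 0 < s) (y : ℝ) :
    HasDerivAt (fun x : ℝ => 2⁻¹ * transitionDensity s x y) (boundaryKernel s y) 0 := by
  have h1 : HasDerivAt (fun x : ℝ => -(y - x) ^ 2 / (2 * s)) (y / s) 0 := by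
    have := ((((hasDerivAt_id (0 : ℝ)).const_sub y).pow 2).neg).div_const (2 * s)
    refine this.congr_deriv ?_
    simp
    field_simp
  have h2 : HasDerivAt (fun x : ℝ => -(y + x) ^ 2 / (2 * s)) (-(y / s)) 0 := by
    have := ((((hasDerivAt_id (0 : ℝ)).const_add y).pow 2).neg).div_const (2 * s)
    refine this.congr_deriv ?_
    simp
    field_simp
  have h := (((h1.exp.const_mul (Real.sqrt (2 * Real.pi * s))⁻¹).sub
    (h2.exp.const_mul (Real.sqrt (2 * Real.pi * s))⁻¹)).const_mul 2⁻¹)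
  refine h.congr_deriv ?_
  simp only [boundaryKernel, heatKernel, sub_zero, add_zero]
  ring

/-- The measure `γ(dy) = (1 - e^{-y²}) dy` on `(0,∞)`. -/
def gam : Measure HalfLine :=
  leb.withDensity
    (fun y => ENNReal.ofReal (1 - Real.exp (-(y : ℝ) ^ 2)))

/-- The Hilbert space `L²(D, γ)`. -/
abbrev H : Type := Lp ℝ 2 gam

/-- The transition semigroup of absorbing-barrier Brownian motion,
`(T_t f)(x) = ∫_D p_t(x,y) f(y) dy`. For `f ∈ L²(D,γ)` the integral converges absolutely at every
`x`, see `integrable_transitionDensity_mul`; since `γ` and Lebesgue measure have the same null sets,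
it does not depend on the representative of `f`. -/
def semigroup (t : HalfLine) (f : HalfLine → ℝ) (x : HalfLine) : ℝ :=
  ∫ y : HalfLine, transitionDensity t x y * f y ∂leb

theorem transitionDensity_eq {s : ℝ} (hs : 0 < s) (x y : ℝ) :
    transitionDensity s x y = heatKernel s (y - x) * (1 - Real.exp (-(2 * x * y / s))) := by
  unfold transitionDensity heatKernel
  have h : Real.exp (-(y + x) ^ 2 / (2 * s)) =
      Real.exp (-(y - x) ^ 2 / (2 * s)) * Real.exp (-(2 * x * y / s)) := by
    rw [← Real.exp_add]
    congr 1
    field_simp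
    ring
  rw [h]
  ring

theorem weight_lower (y : ℝ) : y ^ 2 ≤ (1 - Real.exp (-y ^ 2)) * (1 + y ^ 2) := by
  have h1 : y ^ 2 + 1 ≤ Real.exp (y ^ 2) := Real.add_one_le_exp _
  have h2 : Real.exp (-y ^ 2) * Real.exp (y ^ 2) = 1 := by
    rw [← Real.exp_add]; simp
  have h3 := Real.exp_pos (-y ^ 2)
  nlinarith

theorem integrable_gaussian_bound {t : ℝ} (ht : 0 < t) (x : ℝ) :
    Integrable (fun y : ℝ => heatKernel t (y - x) ^ 2 * (1 + y ^ 2)) := by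
  have hb : 0 < t⁻¹ := inv_pos.mpr ht
  have e0 := integrable_exp_neg_mul_sq hb
  have e1 := integrable_mul_exp_neg_mul_sq hb
  have e2 : Integrable (fun u : ℝ => u ^ 2 * Real.exp (-t⁻¹ * u ^ 2)) := by
    have := integrable_rpow_mul_exp_neg_mul_sq hb (s := 2) (by norm_num)
    simpa using this
  have e3 : Integrable (fun u : ℝ => (2 * Real.pi * t)⁻¹ *
      ((1 + x ^ 2) * Real.exp (-t⁻¹ * u ^ 2) + 2 * x * (u * Real.exp (-t⁻¹ * u ^ 2)) +
        u ^ 2 * Real.exp (-t⁻¹ * u ^ 2))) :=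
    (((e0.const_mul _).add (e1.const_mul _)).add e2).const_mul _
  refine (e3.comp_sub_right x).congr (Filter.Eventually.of_forall fun y => ?_)
  have hsq : (Real.sqrt (2 * Real.pi * t))⁻¹ ^ 2 = (2 * Real.pi * t)⁻¹ := by
    rw [inv_pow, Real.sq_sqrt (by positivity)]
  have hexp : Real.exp (-(y - x) ^ 2 / (2 * t)) ^ 2 = Real.exp (-t⁻¹ * (y - x) ^ 2) := by
    rw [← Real.exp_nat_mul]
    congr 1
    push_cast
    field_simp
  simp only [heatKernel]
  rw [mul_pow, hsq, hexp]
  ring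

/-- The integral that defines the semigroup converges absolutely on `L²(D, γ)`. -/
theorem integrable_transitionDensity_mul (t x : HalfLine) (f : H) :
    Integrable (fun y : HalfLine => transitionDensity t x y * f y) leb := by
  have hw : Measurable (fun y : HalfLine => 1 - Real.exp (-(y : ℝ) ^ 2)) := by fun_prop
  have hw0 : ∀ y : HalfLine, 0 < 1 - Real.exp (-(y : ℝ) ^ 2) := by
    intro y
    have : Real.exp (-(y : ℝ) ^ 2) < 1 := by
      have := y.2
      exact Real.exp_lt_one_iff.2 (by simp; positivity)
    linarith
  have hac : leb ≪ gam :=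
    withDensity_absolutelyContinuous' hw.ennreal_ofReal.aemeasurable
      (Filter.Eventually.of_forall fun y => by
        simpa only [ne_eq, ENNReal.ofReal_eq_zero, not_le] using hw0 y)
  have hfm : AEStronglyMeasurable (f : HalfLine → ℝ) leb :=
    (Lp.aestronglyMeasurable f).mono_ac hac
  have hf2 : Integrable (fun y : HalfLine => (1 - Real.exp (-(y : ℝ) ^ 2)) * f y ^ 2) leb := by
    have h1 : Integrable (fun y => f y ^ 2) gam := (Lp.memLp f).integrable_sq
    unfold gam at h1
    rw [integrable_withDensity_iff_integrable_smul' hw.ennreal_ofReal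
      (Filter.Eventually.of_forall fun y => ENNReal.ofReal_lt_top)] at h1
    refine h1.congr (Filter.Eventually.of_forall fun y => ?_)
    simp only [smul_eq_mul]
    rw [ENNReal.toReal_ofReal (hw0 y).le]
    rfl
  have hg : Integrable (fun y : HalfLine =>
      heatKernel t ((y : ℝ) - x) ^ 2 * (1 + (y : ℝ) ^ 2)) leb := by
    have h1 := (integrable_gaussian_bound t.2 (x : ℝ)).integrableOn (s := Set.Ioi (0 : ℝ))
    exact (integrableOn_iff_comap_subtypeVal measurableSet_Ioi).1 h1
  have hpm : Measurable (fun y : HalfLine => transitionDensity t x y) := by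
    unfold transitionDensity heatKernel
    fun_prop
  refine ((hg.const_mul ((2 * (x : ℝ) / t) ^ 2)).add hf2).mono'
    (hpm.aestronglyMeasurable.mul hfm) (Filter.Eventually.of_forall fun y => ?_)
  have hy := y.2
  have hx := x.2
  have ht := t.2
  simp only [Pi.add_apply, Real.norm_eq_abs]
  rw [transitionDensity_eq ht]
  set w := 1 - Real.exp (-(y : ℝ) ^ 2) with hwdef
  set g := heatKernel t ((y : ℝ) - x)
  set q := 1 - Real.exp (-(2 * (x : ℝ) * y / t)) with hq
  have hq0 : 0 ≤ q := by
    have : Real.exp (-(2 * (x : ℝ) * y / t)) ≤ 1 := Real.exp_le_one_iff.2 (by simp; positivity)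
    linarith
  have hq1 : q ≤ 2 * (x : ℝ) / t * y := by
    have := Real.add_one_le_exp (-(2 * (x : ℝ) * y / t))
    have e : 2 * (x : ℝ) / t * y = 2 * (x : ℝ) * y / t := by ring
    rw [e]; linarith
  have hwy : (y : ℝ) ^ 2 ≤ w * (1 + (y : ℝ) ^ 2) := weight_lower y
  have hwp : 0 < w := hw0 y
  have hq2 : q ^ 2 ≤ (2 * (x : ℝ) / t) ^ 2 * (w * (1 + (y : ℝ) ^ 2)) := by
    calc q ^ 2 ≤ (2 * (x : ℝ) / t * y) ^ 2 := by gcongr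
      _ = (2 * (x : ℝ) / t) ^ 2 * (y : ℝ) ^ 2 := by ring
      _ ≤ _ := by gcongr
  set A := (2 * (x : ℝ) / t) ^ 2 * (g ^ 2 * (1 + (y : ℝ) ^ 2)) with hA
  have hA0 : 0 ≤ A := by positivity
  have hB0 : 0 ≤ w * f y ^ 2 := by positivity
  have hkey : (g * q * f y) ^ 2 ≤ A * (w * f y ^ 2) := by
    calc (g * q * f y) ^ 2 = q ^ 2 * (g ^ 2 * f y ^ 2) := by ring
      _ ≤ ((2 * (x : ℝ) / t) ^ 2 * (w * (1 + (y : ℝ) ^ 2))) * (g ^ 2 * f y ^ 2) := by gcongr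
      _ = A * (w * f y ^ 2) := by rw [hA]; ring
  refine abs_le_of_sq_le_sq ?_ (add_nonneg hA0 hB0)
  nlinarith [mul_nonneg hA0 hB0, sq_nonneg A, sq_nonneg (w * f y ^ 2)]

/-- An entrance path for the semigroup: a family `(x̃(s))_{s>0}` in `L²(D,γ)` such that
`x̃(r+t) = T_t x̃(r)` for all `r, t > 0`. -/
def IsEntrancePath (u : HalfLine → H) : Prop :=
  ∀ r t : HalfLine, (u (r + t) : HalfLine → ℝ) =ᵐ[gam] semigroup t (u r)

/-- Local square integrability: `∫_0^l ‖x̃(s)‖² ds < ∞` for some `l > 0`. -/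
def IsLocallySquareIntegrable (u : HalfLine → H) : Prop :=
  ∃ l : HalfLine, ∫⁻ s in Set.Iio l, ‖u s‖ₑ ^ 2 ∂leb < ⊤

/-- The entrance space: all locally square integrable entrance paths. -/
def entranceSpace : Set (HalfLine → H) :=
  {u | IsEntrancePath u ∧ IsLocallySquareIntegrable u}

/-- The non-negative elements of the entrance space. -/
def nonnegEntranceSpace : Set (HalfLine → H) :=
  {u | u ∈ entranceSpace ∧ ∀ s, 0 ≤ u s}

/-- The (possibly infinite) non-negative Borel measures `μ` on `D` such that
`∫_0^l ds ∫_D (∫_D p_s(x,y) μ(dx))² γ(dy) < ∞` for some `l > 0`. -/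
def entranceMeasures : Set (Measure HalfLine) :=
  {μ | ∃ l : HalfLine, ∫⁻ s in Set.Iio l, ∫⁻ y,
    (∫⁻ x, ENNReal.ofReal (transitionDensity (s : HalfLine) x y) ∂μ) ^ 2 ∂gam ∂leb < ⊤}

/-- `x̃(s,·) = a k_s(·) + ∫_D p_s(z,·) μ(dz)` for all `s > 0`, as an identity in `L²(D,γ)`,
with all the integrals absolutely convergent. -/
def Represents (u : HalfLine → H) (a : ℝ) (μ : Measure HalfLine) : Prop :=
  ∀ s : HalfLine,
    (∀ y : HalfLine, Integrable (fun z : HalfLine => transitionDensity s z y) μ) ∧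
    (u s : HalfLine → ℝ) =ᵐ[gam]
      fun y => a * boundaryKernel s y + ∫ z : HalfLine, transitionDensity s z y ∂μ

end AbsorbingBM

end

/-!
Write `T_t` for the absorbed semigroup. Both building blocks are entrance laws: the
Chapman-Kolmogorov equation gives `T_t p_s(z, ·) = p_{s+t}(z, ·)`, and `T_t k_s = k_{s+t}` is
the corresponding identity for the normal derivative at the boundary; both follow from Gaussian
integrals by odd reflection. Almost all of the work is done with functions valued in `[0, ∞]`,
where Tonelli's theorem applies without integrability assumptions.

*From pairs to paths* (`exists_represents`). The semigroup is bounded on `L²(D, γ)` by a Schur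
test with weight `y / (1 + y)` (`exists_lintegral_sq_heatOp_le`). Since the integral condition
on `μ` provides arbitrarily small times at which the potential of `μ` is in `L²(D, γ)`, it is
so, and is finite everywhere, at all times. The term `a k_s` is admissible because
`‖k_s‖² = O(s^{-1/2})`.

*Uniqueness* (`represents_unique`). One time suffices. At time `1` the law, divided by
`g₁(1, y)`, is `M(y) = a y + 2 ∫ e^{-z²/2} sinh(y z) μ(dz)`, and the difference `M(y+1) - M(y-1)` is
twice the Laplace transform of the finite measure on `ℝ` obtained by adding `a δ₀` to the
symmetric extension of `e^{-z²/2} sinh(z) μ(dz)`. A finite Laplace transform determines the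
measure.

*From paths to pairs* (`exists_represents_of_mem`). For a non-negative entrance path with values
`F_s`, the measures `x e^{-x²/2} F_s(x) dx` on `[0, ∞)` have bounded mass as `s → 0`, because
they are dominated by a multiple of `p_1(x, 1) F_s(x) dx`, whose mass `T_1 F_s(1)` is bounded;
the same bound with `x e^{-x²/4}` gives tightness. Prokhorov's theorem yields a limit point `η`.
For `t < 1` the ratio of `p_t(x, y)` to `x e^{-x²/2}` extends to a bounded continuous function
of `x ∈ [0, ∞)`, with a multiple of `k_t(y)` as its value at `0`, so passing to the limit in
`T_t F_s(y) = ∫ p_t(x, y) F_s(x) dx` gives the representation: the atom of `η` at `0` becomes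
`a`, and the rest of `η` becomes `μ`. The semigroup property extends it to all times.
-/

noncomputable section

namespace AbsorbingBM

open scoped ENNReal NNReal Topology
open Filter

/-! ### The heat kernel and the absorbed transition density -/

theorem heatKernel_nonneg (s x : ℝ) : 0 ≤ heatKernel s x := by
  unfold heatKernel; positivity

theorem heatKernel_pos {s : ℝ} (hs : 0 < s) (x : ℝ) : 0 < heatKernel s x := by
  unfold heatKernel; positivity

theorem heatKernel_neg (s x : ℝ) : heatKernel s (-x) = heatKernel s x := by
  unfold heatKernel; rw [neg_sq]

theorem heatKernel_sub_eq_gaussianPDFReal {r : ℝ} (hr : 0 < r) (m z : ℝ) :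
    heatKernel r (z - m) = ProbabilityTheory.gaussianPDFReal m ⟨r, hr.le⟩ z := rfl

theorem integrable_heatKernel_sub {r : ℝ} (hr : 0 < r) (m : ℝ) :
    Integrable fun z => heatKernel r (z - m) :=
  ProbabilityTheory.integrable_gaussianPDFReal m ⟨r, hr.le⟩

theorem integral_heatKernel_sub {r : ℝ} (hr : 0 < r) (m : ℝ) :
    ∫ z, heatKernel r (z - m) = 1 :=
  ProbabilityTheory.integral_gaussianPDFReal_eq_one m
    (v := ⟨r, hr.le⟩) (by intro h; exact hr.ne' (congrArg NNReal.toReal h))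

theorem integral_mul_heatKernel_sub {r : ℝ} (hr : 0 < r) (m : ℝ) :
    ∫ z, z * heatKernel r (z - m) = m := by
  have hv : (⟨r, hr.le⟩ : NNReal) ≠ 0 := by
    intro h; exact hr.ne' (congrArg NNReal.toReal h)
  have h := ProbabilityTheory.integral_id_gaussianReal (μ := m) (v := ⟨r, hr.le⟩)
  rw [ProbabilityTheory.integral_gaussianReal_eq_integral_smul hv] at h
  refine Eq.trans (integral_congr_ae (Filter.Eventually.of_forall fun z => ?_)) h
  simp only [smul_eq_mul, heatKernel_sub_eq_gaussianPDFReal hr, mul_comm]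

theorem integrable_mul_heatKernel_sub {r : ℝ} (hr : 0 < r) (m : ℝ) :
    Integrable fun z => z * heatKernel r (z - m) := by
  have hb : 0 < (2 * r)⁻¹ := by positivity
  have e0 := integrable_exp_neg_mul_sq hb
  have e1 := integrable_mul_exp_neg_mul_sq hb
  have e2 := ((e1.add (e0.const_mul m)).const_mul (Real.sqrt (2 * Real.pi * r))⁻¹).comp_sub_right m
  refine e2.congr (Filter.Eventually.of_forall fun z => ?_)
  have : -(z - m) ^ 2 / (2 * r) = -(2 * r)⁻¹ * (z - m) ^ 2 := by field_simp
  simp only [heatKernel, this, Pi.add_apply]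
  ring

/-- Completing the square: a product of two Gaussian densities is a multiple of a third one. -/
theorem heatKernel_mul_heatKernel {s t : ℝ} (hs : 0 < s) (ht : 0 < t) (x y z : ℝ) :
    heatKernel t (z - x) * heatKernel s (z - y) =
      heatKernel (s + t) (x - y) *
        heatKernel (s * t / (s + t)) (z - (s * x + t * y) / (s + t)) := by
  have hst : 0 < s + t := by positivity
  unfold heatKernel
  have e1 : (Real.sqrt (2 * Real.pi * t))⁻¹ * (Real.sqrt (2 * Real.pi * s))⁻¹ =
      (Real.sqrt (2 * Real.pi * (s + t)))⁻¹ *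
        (Real.sqrt (2 * Real.pi * (s * t / (s + t))))⁻¹ := by
    rw [← mul_inv, ← mul_inv, ← Real.sqrt_mul (by positivity), ← Real.sqrt_mul (by positivity)]
    congr 2
    field_simp
  have e2 : Real.exp (-(z - x) ^ 2 / (2 * t)) * Real.exp (-(z - y) ^ 2 / (2 * s)) =
      Real.exp (-(x - y) ^ 2 / (2 * (s + t))) *
        Real.exp (-(z - (s * x + t * y) / (s + t)) ^ 2 / (2 * (s * t / (s + t)))) := by
    rw [← Real.exp_add, ← Real.exp_add]
    congr 1
    field_simp
    ring
  calc _ = ((Real.sqrt (2 * Real.pi * t))⁻¹ * (Real.sqrt (2 * Real.pi * s))⁻¹) *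
      (Real.exp (-(z - x) ^ 2 / (2 * t)) * Real.exp (-(z - y) ^ 2 / (2 * s))) := by ring
    _ = _ := by rw [e1, e2]; ring

theorem transitionDensity_symm (s x y : ℝ) :
    transitionDensity s x y = transitionDensity s y x := by
  unfold transitionDensity
  rw [← heatKernel_neg s (y - x), neg_sub, add_comm]

theorem transitionDensity_pos {s x y : ℝ} (hs : 0 < s) (hx : 0 < x) (hy : 0 < y) :
    0 < transitionDensity s x y := by
  rw [transitionDensity_eq hs]
  refine mul_pos (heatKernel_pos hs _) (sub_pos.2 (Real.exp_lt_one_iff.2 ?_))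
  have : 0 < 2 * x * y / s := by positivity
  linarith

theorem transitionDensity_le_heatKernel (s x y : ℝ) :
    transitionDensity s x y ≤ heatKernel s (y - x) := by
  unfold transitionDensity
  linarith [heatKernel_nonneg s (y + x)]

/-- The transition density separates into Gaussian factors and a hyperbolic sine. -/
theorem transitionDensity_eq_sinh {s : ℝ} (hs : 0 < s) (x y : ℝ) :
    transitionDensity s x y =
      2 * heatKernel s y * (Real.exp (-x ^ 2 / (2 * s)) * Real.sinh (y / s * x)) := by
  unfold transitionDensity heatKernel
  have h1 : Real.exp (-(y - x) ^ 2 / (2 * s)) = Real.exp (-y ^ 2 / (2 * s)) *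
      Real.exp (-x ^ 2 / (2 * s)) * Real.exp (y / s * x) := by
    rw [← Real.exp_add, ← Real.exp_add]; congr 1; field_simp; ring
  have h2 : Real.exp (-(y + x) ^ 2 / (2 * s)) = Real.exp (-y ^ 2 / (2 * s)) *
      Real.exp (-x ^ 2 / (2 * s)) * Real.exp (-(y / s * x)) := by
    rw [← Real.exp_add, ← Real.exp_add]; congr 1; field_simp; ring
  rw [h1, h2, Real.sinh_eq]
  ring

theorem heatKernel_le_mul {σ t : ℝ} (hσ : 0 < σ) (h : σ ≤ t) (x : ℝ) :
    heatKernel σ x ≤ t / σ * heatKernel t x := by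
  have ht : 0 < t := hσ.trans_le h
  have h1 : (Real.sqrt (2 * Real.pi * σ))⁻¹ ≤ t / σ * (Real.sqrt (2 * Real.pi * t))⁻¹ := by
    have hσt : 1 ≤ t / σ := (one_le_div hσ).2 h
    rw [← div_eq_mul_inv, inv_le_comm₀ (by positivity) (by positivity), inv_div,
      div_le_iff₀ (by positivity)]
    calc Real.sqrt (2 * Real.pi * t) = Real.sqrt (t / σ * (2 * Real.pi * σ)) := by
          congr 1; field_simp
      _ ≤ Real.sqrt ((t / σ) ^ 2 * (2 * Real.pi * σ)) := by
          gcongr; nlinarith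
      _ = _ := by
          rw [Real.sqrt_mul (by positivity), Real.sqrt_sq (by positivity), mul_comm]
  have h2 : Real.exp (-x ^ 2 / (2 * σ)) ≤ Real.exp (-x ^ 2 / (2 * t)) := by
    refine Real.exp_le_exp.2 ?_
    rw [neg_div, neg_div, neg_le_neg_iff]
    gcongr
  unfold heatKernel
  calc _ ≤ (t / σ * (Real.sqrt (2 * Real.pi * t))⁻¹) * Real.exp (-x ^ 2 / (2 * t)) := by gcongr
    _ = _ := by ring

/-- A transition density is dominated by a multiple of the one at any later time. -/
theorem transitionDensity_le_mul {σ t x y : ℝ} (hσ : 0 < σ) (h : σ ≤ t) (hx : 0 < x)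
    (hy : 0 < y) : transitionDensity σ x y ≤ (t / σ) ^ 2 * transitionDensity t x y := by
  have ht : 0 < t := hσ.trans_le h
  rw [transitionDensity_eq hσ, transitionDensity_eq ht]
  have hq : 1 - Real.exp (-(2 * x * y / σ)) ≤ t / σ * (1 - Real.exp (-(2 * x * y / t))) := by
    -- Bernoulli's inequality for the power `t / σ ≥ 1` of `exp (-2xy/t)`
    have := one_add_mul_self_le_rpow_one_add (s := Real.exp (-(2 * x * y / t)) - 1)
      (by linarith [Real.exp_pos (-(2 * x * y / t))]) ((one_le_div hσ).2 h)
    rw [add_sub_cancel, ← Real.exp_mul] at this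
    have e : -(2 * x * y / t) * (t / σ) = -(2 * x * y / σ) := by field_simp
    rw [e] at this
    linarith
  have h0 : 0 ≤ 1 - Real.exp (-(2 * x * y / σ)) :=
    sub_nonneg.2 (Real.exp_le_one_iff.2 (by simp; positivity))
  calc _ ≤ (t / σ * heatKernel t (y - x)) * (t / σ * (1 - Real.exp (-(2 * x * y / t)))) := by
        refine mul_le_mul (heatKernel_le_mul hσ h _) hq h0 ?_
        have := heatKernel_nonneg t (y - x); positivity
    _ = _ := by ring

theorem boundaryKernel_nonneg {s y : ℝ} (hs : 0 < s) (hy : 0 < y) : 0 ≤ boundaryKernel s y := by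
  have := heatKernel_nonneg s y
  unfold boundaryKernel; positivity

/-- Reflection principle: on odd functions the absorbed semigroup agrees with the heat semigroup of
the whole line. -/
theorem setIntegral_transitionDensity_mul_of_odd {t x : ℝ} {f : ℝ → ℝ}
    (hodd : ∀ z, f (-z) = -f z)
    (hint : Integrable fun z => heatKernel t (z - x) * f z) :
    IntegrableOn (fun z => transitionDensity t x z * f z) (Set.Ioi 0) ∧
      ∫ z in Set.Ioi 0, transitionDensity t x z * f z = ∫ z, heatKernel t (z - x) * f z := by
  have e : ∀ z, heatKernel t (-z - x) * f (-z) = -(heatKernel t (z + x) * f z) := fun z => by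
    rw [hodd, ← heatKernel_neg t (-z - x)]
    ring_nf
  have hint2 : Integrable fun z => heatKernel t (z + x) * f z :=
    (hint.comp_neg.neg).congr (Filter.Eventually.of_forall fun z => by
      simp only [Pi.neg_apply, e, neg_neg])
  have e2 : (fun z => transitionDensity t x z * f z) =
      fun z => heatKernel t (z - x) * f z - heatKernel t (z + x) * f z := by
    ext z; unfold transitionDensity; ring
  rw [e2]
  refine ⟨(hint.sub hint2).integrableOn, ?_⟩
  rw [integral_sub hint.integrableOn hint2.integrableOn,
    ← integral_add_compl measurableSet_Ioi hint (s := Set.Ioi 0), Set.compl_Ioi]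
  have h3 := integral_comp_neg_Ioi (0 : ℝ) (fun z => heatKernel t (z - x) * f z)
  rw [neg_zero] at h3
  rw [← h3]
  simp only [e, integral_neg]
  ring

/-- The Chapman-Kolmogorov equation. -/
theorem setIntegral_transitionDensity_mul_transitionDensity {s t : ℝ} (hs : 0 < s) (ht : 0 < t)
    (x y : ℝ) :
    IntegrableOn (fun z => transitionDensity t x z * transitionDensity s z y) (Set.Ioi 0) ∧
      ∫ z in Set.Ioi 0, transitionDensity t x z * transitionDensity s z y =
        transitionDensity (t + s) x y := by
  have hr : 0 < s * t / (s + t) := by positivity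
  have e : (fun z => heatKernel t (z - x) * transitionDensity s z y) = fun z =>
      heatKernel (s + t) (x - y) *
        heatKernel (s * t / (s + t)) (z - (s * x + t * y) / (s + t)) -
      heatKernel (s + t) (x - -y) *
        heatKernel (s * t / (s + t)) (z - (s * x + t * -y) / (s + t)) := by
    ext z
    rw [← heatKernel_mul_heatKernel hs ht, ← heatKernel_mul_heatKernel hs ht,
      transitionDensity_symm]
    unfold transitionDensity
    rw [sub_neg_eq_add]; ring
  have i1 := (integrable_heatKernel_sub hr ((s * x + t * y) / (s + t))).const_mul
    (heatKernel (s + t) (x - y))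
  have i2 := (integrable_heatKernel_sub hr ((s * x + t * -y) / (s + t))).const_mul
    (heatKernel (s + t) (x - -y))
  have hint : Integrable fun z => heatKernel t (z - x) * transitionDensity s z y := by
    rw [e]; exact i1.sub i2
  have h := setIntegral_transitionDensity_mul_of_odd (t := t) (x := x)
    (f := fun z => transitionDensity s z y) (fun z => by
      unfold transitionDensity
      ring_nf) hint
  refine ⟨h.1, h.2.trans ?_⟩
  rw [e, integral_sub i1 i2, integral_const_mul, integral_const_mul,
    integral_heatKernel_sub hr, integral_heatKernel_sub hr, transitionDensity_symm]
  unfold transitionDensity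
  rw [add_comm s t]
  ring_nf

/-- The boundary kernels form an entrance law. -/
theorem setIntegral_transitionDensity_mul_boundaryKernel {s t : ℝ} (hs : 0 < s) (ht : 0 < t)
    (x : ℝ) :
    IntegrableOn (fun z => transitionDensity t x z * boundaryKernel s z) (Set.Ioi 0) ∧
      ∫ z in Set.Ioi 0, transitionDensity t x z * boundaryKernel s z =
        boundaryKernel (t + s) x := by
  have hr : 0 < s * t / (s + t) := by positivity
  have e : (fun z => heatKernel t (z - x) * boundaryKernel s z) = fun z =>
      heatKernel (s + t) x / s * (z *
        heatKernel (s * t / (s + t)) (z - (s * x) / (s + t))) := by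
    ext z
    have := heatKernel_mul_heatKernel hs ht x 0 z
    simp only [sub_zero, mul_zero, add_zero] at this
    unfold boundaryKernel
    linear_combination (z / s) * this
  have i1 := (integrable_mul_heatKernel_sub hr ((s * x) / (s + t))).const_mul
    (heatKernel (s + t) x / s)
  have h := setIntegral_transitionDensity_mul_of_odd (t := t) (x := x)
    (f := fun z => boundaryKernel s z) (fun z => by
      unfold boundaryKernel
      rw [heatKernel_neg]; ring) (by rw [e]; exact i1)
  refine ⟨h.1, h.2.trans ?_⟩
  rw [e, integral_const_mul, integral_mul_heatKernel_sub hr]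
  unfold boundaryKernel
  rw [add_comm s t]
  field_simp

/-! ### The semigroup on functions with values in `[0, ∞]` -/

theorem measurableEmbedding_val : MeasurableEmbedding (Subtype.val : HalfLine → ℝ) :=
  MeasurableEmbedding.subtype_coe measurableSet_Ioi

instance : SigmaFinite leb := by
  refine SigmaFinite.of_map leb measurableEmbedding_val.measurable.aemeasurable ?_
  unfold leb
  rw [measurableEmbedding_val.map_comap]
  infer_instance

theorem lintegral_leb (f : ℝ → ℝ≥0∞) : ∫⁻ x : HalfLine, f x ∂leb = ∫⁻ x in Set.Ioi 0, f x :=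
  lintegral_subtype_comap measurableSet_Ioi f

theorem lintegral_leb_ofReal {f : ℝ → ℝ} (hf : IntegrableOn f (Set.Ioi 0))
    (h0 : ∀ x, 0 < x → 0 ≤ f x) :
    ∫⁻ x : HalfLine, ENNReal.ofReal (f x) ∂leb = ENNReal.ofReal (∫ x in Set.Ioi 0, f x) := by
  rw [lintegral_leb fun x => ENNReal.ofReal (f x), ofReal_integral_eq_lintegral_ofReal hf]
  exact (ae_restrict_mem measurableSet_Ioi).mono h0

/-- The density of `γ` with respect to Lebesgue measure. -/
def weight (y : HalfLine) : ℝ≥0∞ := ENNReal.ofReal (1 - Real.exp (-(y : ℝ) ^ 2))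

theorem measurable_weight : Measurable weight := by
  unfold weight; fun_prop

theorem weight_ne_zero (y : HalfLine) : weight y ≠ 0 := by
  have := y.2
  have h : Real.exp (-(y : ℝ) ^ 2) < 1 := Real.exp_lt_one_iff.2 (by linarith [pow_pos this 2])
  rw [weight, ne_eq, ENNReal.ofReal_eq_zero, not_le]
  linarith

theorem weight_le_one (y : HalfLine) : weight y ≤ 1 := by
  unfold weight
  refine ENNReal.ofReal_le_one.2 ?_
  linarith [Real.exp_pos (-(y : ℝ) ^ 2)]

theorem lintegral_gam {F : HalfLine → ℝ≥0∞} (hF : Measurable F) :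
    ∫⁻ y, F y ∂gam = ∫⁻ y, weight y * F y ∂leb :=
  lintegral_withDensity_eq_lintegral_mul _ measurable_weight hF

theorem leb_absolutelyContinuous_gam : leb ≪ gam :=
  withDensity_absolutelyContinuous' measurable_weight.aemeasurable
    (Filter.Eventually.of_forall weight_ne_zero)

theorem gam_absolutelyContinuous_leb : gam ≪ leb :=
  withDensity_absolutelyContinuous _ _

theorem gam_ne_zero : gam ≠ 0 := by
  intro h
  have h1 : leb Set.univ = 0 := leb_absolutelyContinuous_gam (by rw [h]; rfl)
  have h2 : leb Set.univ = ⊤ := by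
    unfold leb
    rw [measurableEmbedding_val.comap_apply, Set.image_univ, Subtype.range_coe_subtype]
    exact Real.volume_Ioi
  rw [h1] at h2
  exact ENNReal.zero_ne_top h2

/-- The transition density `p_t` as an extended non-negative kernel. The time is a real number, and
only positive times are meaningful. -/
def kernel (t : ℝ) (x y : HalfLine) : ℝ≥0∞ := ENNReal.ofReal (transitionDensity t x y)

/-- The semigroup acting on extended non-negative functions. -/
def heatOp (t : ℝ) (F : HalfLine → ℝ≥0∞) (x : HalfLine) : ℝ≥0∞ := ∫⁻ y, kernel t x y * F y ∂leb

/-- The boundary kernel `k_s` as an extended non-negative function. -/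
def boundaryFun (s : ℝ) (y : HalfLine) : ℝ≥0∞ := ENNReal.ofReal (boundaryKernel s y)

/-- The heat potential `y ↦ ∫ p_s(z, y) μ(dz)` of a measure. -/
def potential (μ : Measure HalfLine) (s : ℝ) (y : HalfLine) : ℝ≥0∞ := ∫⁻ z, kernel s z y ∂μ

@[fun_prop]
theorem measurable_kernel {α : Type*} [MeasurableSpace α] {t : ℝ} {f g : α → HalfLine}
    (hf : Measurable f) (hg : Measurable g) : Measurable fun a => kernel t (f a) (g a) := by
  unfold kernel transitionDensity heatKernel
  fun_prop

theorem kernel_symm (t : ℝ) (x y : HalfLine) : kernel t x y = kernel t y x := by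
  unfold kernel; rw [transitionDensity_symm]

theorem kernel_ne_zero {t : ℝ} (ht : 0 < t) (x y : HalfLine) : kernel t x y ≠ 0 := by
  have := transitionDensity_pos ht x.2 y.2
  simpa [kernel] using this

theorem kernel_ne_top (t : ℝ) (x y : HalfLine) : kernel t x y ≠ ⊤ := ENNReal.ofReal_ne_top

@[fun_prop]
theorem measurable_boundaryFun (s : ℝ) : Measurable (boundaryFun s) := by
  unfold boundaryFun boundaryKernel heatKernel
  fun_prop

@[fun_prop]
theorem measurable_heatOp (t : ℝ) {F : HalfLine → ℝ≥0∞} (hF : Measurable F) :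
    Measurable (heatOp t F) := by
  have h : Measurable fun q : HalfLine × HalfLine => kernel t q.1 q.2 * F q.2 := by fun_prop
  exact h.lintegral_prod_right'

@[fun_prop]
theorem measurable_potential (μ : Measure HalfLine) [SFinite μ] (s : ℝ) :
    Measurable (potential μ s) := by
  have h : Measurable fun q : HalfLine × HalfLine => kernel s q.1 q.2 := by fun_prop
  exact h.lintegral_prod_left'

theorem heatOp_congr {t : ℝ} {F G : HalfLine → ℝ≥0∞} (h : F =ᵐ[leb] G) :
    heatOp t F = heatOp t G := by
  ext x
  exact lintegral_congr_ae (h.mono fun y hy => by simp only [hy])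

theorem heatOp_kernel {s t : ℝ} (hs : 0 < s) (ht : 0 < t) (x y : HalfLine) :
    heatOp t (fun z => kernel s z y) x = kernel (t + s) x y := by
  have h := setIntegral_transitionDensity_mul_transitionDensity hs ht x y
  unfold heatOp kernel
  rw [← h.2, ← lintegral_leb_ofReal h.1]
  · refine lintegral_congr fun z => ?_
    rw [ENNReal.ofReal_mul (transitionDensity_pos ht x.2 z.2).le]
  · intro z hz
    exact (mul_pos (transitionDensity_pos ht x.2 hz) (transitionDensity_pos hs hz y.2)).le

theorem heatOp_boundaryFun {s t : ℝ} (hs : 0 < s) (ht : 0 < t) :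
    heatOp t (boundaryFun s) = boundaryFun (t + s) := by
  ext x
  have h := setIntegral_transitionDensity_mul_boundaryKernel hs ht x
  unfold heatOp kernel boundaryFun
  rw [← h.2, ← lintegral_leb_ofReal h.1]
  · refine lintegral_congr fun z => ?_
    rw [ENNReal.ofReal_mul (transitionDensity_pos ht x.2 z.2).le]
  · intro z hz
    exact mul_nonneg (transitionDensity_pos ht x.2 hz).le (boundaryKernel_nonneg hs hz)

theorem heatOp_heatOp {s t : ℝ} (hs : 0 < s) (ht : 0 < t) {F : HalfLine → ℝ≥0∞}
    (hF : Measurable F) : heatOp t (heatOp s F) = heatOp (t + s) F := by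
  ext x
  have h1 : ∀ z, kernel t x z * heatOp s F z = ∫⁻ y, kernel t x z * (kernel s z y * F y) ∂leb :=
    fun z => (lintegral_const_mul _ (by fun_prop)).symm
  have h2 : ∀ y, ∫⁻ z, kernel t x z * (kernel s z y * F y) ∂leb = kernel (t + s) x y * F y := by
    intro y
    rw [← heatOp_kernel hs ht, heatOp, ← lintegral_mul_const _ (by fun_prop)]
    simp only [mul_assoc]
  unfold heatOp at h1 ⊢
  simp only [h1]
  rw [lintegral_lintegral_swap]
  · exact lintegral_congr h2
  · refine Measurable.aemeasurable ?_
    unfold Function.uncurry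
    fun_prop

theorem heatOp_potential {s t : ℝ} (hs : 0 < s) (ht : 0 < t) (μ : Measure HalfLine) [SFinite μ] :
    heatOp t (potential μ s) = potential μ (t + s) := by
  ext x
  have h1 : ∀ y, kernel t x y * potential μ s y = ∫⁻ z, kernel t x y * kernel s z y ∂μ :=
    fun y => (lintegral_const_mul _ (by fun_prop)).symm
  unfold heatOp
  simp only [h1]
  rw [lintegral_lintegral_swap]
  · refine lintegral_congr fun z => ?_
    rw [kernel_symm _ z x, ← heatOp_kernel hs ht]
    exact lintegral_congr fun y => by rw [kernel_symm s z y]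
  · refine Measurable.aemeasurable ?_
    unfold Function.uncurry
    fun_prop

theorem heatOp_add {t : ℝ} {F G : HalfLine → ℝ≥0∞} (hF : Measurable F) (x : HalfLine) :
    heatOp t (fun y => F y + G y) x = heatOp t F x + heatOp t G x := by
  unfold heatOp
  simp only [mul_add]
  exact lintegral_add_left (by fun_prop) _

theorem heatOp_const_mul {t : ℝ} {F : HalfLine → ℝ≥0∞} (hF : Measurable F) (c : ℝ≥0∞)
    (x : HalfLine) : heatOp t (fun y => c * F y) x = c * heatOp t F x := by
  unfold heatOp
  rw [← lintegral_const_mul _ (by fun_prop)]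
  exact lintegral_congr fun y => by ring

/-- The function `a k_s + ∫ p_s(z, ·) μ(dz)` with values in `[0, ∞]`. -/
def entranceLaw (a : ℝ≥0∞) (μ : Measure HalfLine) (s : ℝ) (y : HalfLine) : ℝ≥0∞ :=
  a * boundaryFun s y + potential μ s y

@[fun_prop]
theorem measurable_entranceLaw (a : ℝ≥0∞) (μ : Measure HalfLine) [SFinite μ] (s : ℝ) :
    Measurable (entranceLaw a μ s) :=
  ((measurable_boundaryFun s).const_mul a).add (measurable_potential μ s)

theorem heatOp_entranceLaw {s t : ℝ} (hs : 0 < s) (ht : 0 < t) (a : ℝ≥0∞)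
    (μ : Measure HalfLine) [SFinite μ] :
    heatOp t (entranceLaw a μ s) = entranceLaw a μ (t + s) := by
  ext x
  unfold entranceLaw
  rw [heatOp_add ((measurable_boundaryFun s).const_mul a),
    heatOp_const_mul (measurable_boundaryFun s), heatOp_boundaryFun hs ht,
    heatOp_potential hs ht]

/-! ### Boundedness on `L²(D, γ)` -/

/-- Weighted Cauchy-Schwarz inequality, as used in the Schur test. -/
theorem sq_lintegral_mul_le {α : Type*} [MeasurableSpace α] {μ : Measure α} {k h F : α → ℝ≥0∞}
    (hk : Measurable k) (hh : Measurable h) (hF : Measurable F) (h0 : ∀ y, h y ≠ 0)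
    (h1 : ∀ y, h y ≠ ⊤) :
    (∫⁻ y, k y * F y ∂μ) ^ 2 ≤ (∫⁻ y, k y * (h y)⁻¹ ∂μ) * ∫⁻ y, k y * (h y * F y ^ 2) ∂μ := by
  have key := ENNReal.lintegral_mul_norm_pow_le (μ := μ) (f := fun y => k y * (h y)⁻¹)
    (g := fun y => k y * (h y * F y ^ 2)) (by fun_prop) (by fun_prop)
    (p := 1 / 2) (q := 1 / 2) (by norm_num) (by norm_num) (by norm_num)
  have e : ∀ y, (k y * (h y)⁻¹) ^ (1 / 2 : ℝ) * (k y * (h y * F y ^ 2)) ^ (1 / 2 : ℝ) =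
      k y * F y := by
    intro y
    rw [← ENNReal.mul_rpow_of_nonneg _ _ (by norm_num)]
    have : k y * (h y)⁻¹ * (k y * (h y * F y ^ 2)) = (k y * F y) ^ (2 : ℝ) := by
      have hi := ENNReal.inv_mul_cancel (h0 y) (h1 y)
      rw [ENNReal.rpow_two]
      calc _ = ((h y)⁻¹ * h y) * (k y * F y) ^ 2 := by ring
        _ = _ := by rw [hi, one_mul]
    rw [this, ← ENNReal.rpow_mul]
    norm_num
  simp only [e] at key
  calc _ ≤ ((∫⁻ y, k y * (h y)⁻¹ ∂μ) ^ (1 / 2 : ℝ) *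
      (∫⁻ y, k y * (h y * F y ^ 2) ∂μ) ^ (1 / 2 : ℝ)) ^ 2 := by gcongr
    _ = _ := by
      rw [mul_pow, ← ENNReal.rpow_two, ← ENNReal.rpow_two, ← ENNReal.rpow_mul,
        ← ENNReal.rpow_mul]
      norm_num

/-- The weight `y / (1 + y)` for the Schur test; its square is comparable to the density of `γ`. -/
def schurWeight (y : HalfLine) : ℝ≥0∞ := ENNReal.ofReal ((y : ℝ) / (1 + y))

@[fun_prop]
theorem measurable_schurWeight : Measurable schurWeight := by
  unfold schurWeight; fun_prop

theorem schurWeight_ne_zero (y : HalfLine) : schurWeight y ≠ 0 := by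
  have := y.2
  rw [schurWeight, ne_eq, ENNReal.ofReal_eq_zero, not_le]
  positivity

theorem schurWeight_ne_top (y : HalfLine) : schurWeight y ≠ ⊤ := ENNReal.ofReal_ne_top

theorem schurWeight_sq_le (y : HalfLine) : schurWeight y ^ 2 ≤ weight y := by
  have hy := y.2
  unfold schurWeight weight
  rw [← ENNReal.ofReal_pow (by positivity)]
  refine ENNReal.ofReal_le_ofReal ?_
  have h := weight_lower y
  have h2 : (0 : ℝ) ≤ 1 - Real.exp (-(y : ℝ) ^ 2) := by
    by_contra hlt
    push Not at hlt
    nlinarith [pow_pos hy 2]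
  rw [div_pow, div_le_iff₀ (by positivity)]
  nlinarith

/-- A profile `b` with `p_t(x, y) (1 + 1 / y) ≤ b (y - x)`. -/
def schurProfile (t u : ℝ) : ℝ := (2 + 2 / t * (1 + |u|)) * heatKernel t u

theorem integrable_schurProfile {t : ℝ} (ht : 0 < t) : Integrable (schurProfile t) := by
  have h1 := integrable_heatKernel_sub ht 0
  have h2 := (integrable_mul_heatKernel_sub ht 0).norm
  refine ((h1.const_mul (2 + 2 / t)).add (h2.const_mul (2 / t))).congr
    (Filter.Eventually.of_forall fun u => ?_)
  simp only [Pi.add_apply, sub_zero, norm_mul, Real.norm_eq_abs,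
    abs_of_nonneg (heatKernel_nonneg t u), schurProfile]
  ring

theorem kernel_mul_inv_schurWeight_le {t : ℝ} (ht : 0 < t) (x y : HalfLine) :
    kernel t x y * (schurWeight y)⁻¹ ≤ ENNReal.ofReal (schurProfile t ((y : ℝ) - x)) := by
  have hx := x.2
  have hy := y.2
  unfold kernel schurWeight
  rw [← ENNReal.ofReal_inv_of_pos (by positivity),
    ← ENNReal.ofReal_mul (transitionDensity_pos ht hx hy).le]
  refine ENNReal.ofReal_le_ofReal ?_
  set g := heatKernel t ((y : ℝ) - x) with hg
  have hg0 : 0 ≤ g := heatKernel_nonneg _ _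
  have hp : transitionDensity t x y ≤ g := transitionDensity_le_heatKernel _ _ _
  have hp0 := (transitionDensity_pos ht hx hy).le
  have habs : (x : ℝ) - y ≤ |(y : ℝ) - x| := by rw [abs_sub_comm]; exact le_abs_self _
  have e : transitionDensity t x y * ((y : ℝ) / (1 + y))⁻¹ =
      transitionDensity t x y + transitionDensity t x y / y := by
    field_simp
    ring
  have hdiv : transitionDensity t x y / y ≤ g + 2 / t * (1 + |(y : ℝ) - x|) * g := by
    rcases le_or_gt 1 (y : ℝ) with h1 | h1
    · have h2 : transitionDensity t x y / y ≤ g := (div_le_self hp0 h1).trans hp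
      have : 0 ≤ 2 / t * (1 + |(y : ℝ) - x|) * g := by positivity
      linarith
    · have h2 : transitionDensity t x y / y ≤ 2 / t * x * g := by
        rw [div_le_iff₀ hy, transitionDensity_eq ht]
        have := Real.add_one_le_exp (-(2 * (x : ℝ) * y / t))
        calc g * (1 - Real.exp (-(2 * (x : ℝ) * y / t))) ≤ g * (2 * (x : ℝ) * y / t) := by
              gcongr; linarith
          _ = _ := by ring
      have h3 : 2 / t * (x : ℝ) * g ≤ 2 / t * (1 + |(y : ℝ) - x|) * g := by
        gcongr; linarith
      linarith
  rw [e]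
  unfold schurProfile
  rw [← hg]
  linarith

theorem lintegral_schurProfile_ne_top {t : ℝ} (ht : 0 < t) :
    ∫⁻ u, ENNReal.ofReal (schurProfile t u) ≠ ⊤ := by
  rw [← lt_top_iff_ne_top]
  exact (integrable_schurProfile ht).lintegral_lt_top

theorem lintegral_kernel_mul_inv_schurWeight_le_right {t : ℝ} (ht : 0 < t) (x : HalfLine) :
    ∫⁻ y, kernel t x y * (schurWeight y)⁻¹ ∂leb ≤ ∫⁻ u, ENNReal.ofReal (schurProfile t u) := by
  refine (lintegral_mono (kernel_mul_inv_schurWeight_le ht x)).trans ?_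
  rw [lintegral_leb fun y => ENNReal.ofReal (schurProfile t (y - x))]
  refine (setLIntegral_le_lintegral _ _).trans_eq ?_
  exact lintegral_sub_right_eq_self (fun u => ENNReal.ofReal (schurProfile t u)) (x : ℝ)

theorem lintegral_kernel_mul_inv_schurWeight_le_left {t : ℝ} (ht : 0 < t) (y : HalfLine) :
    ∫⁻ x, kernel t x y * (schurWeight y)⁻¹ ∂leb ≤ ∫⁻ u, ENNReal.ofReal (schurProfile t u) := by
  refine (lintegral_mono fun x => kernel_mul_inv_schurWeight_le ht x y).trans ?_
  rw [lintegral_leb fun x => ENNReal.ofReal (schurProfile t (y - x))]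
  refine (setLIntegral_le_lintegral _ _).trans_eq ?_
  exact lintegral_sub_left_eq_self (fun u => ENNReal.ofReal (schurProfile t u)) (y : ℝ)

theorem lintegral_kernel_le {t : ℝ} (ht : 0 < t) (y : HalfLine) :
    ∫⁻ x, kernel t x y ∂leb ≤ (∫⁻ u, ENNReal.ofReal (schurProfile t u)) * schurWeight y := by
  have h := lintegral_kernel_mul_inv_schurWeight_le_left ht y
  rw [lintegral_mul_const _ (by fun_prop)] at h
  rwa [← div_eq_mul_inv, ENNReal.div_le_iff (schurWeight_ne_zero y) (schurWeight_ne_top y)] at h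

/-- The semigroup is bounded on `L²(D, γ)`, by the Schur test with weight `y / (1 + y)`. -/
theorem exists_lintegral_sq_heatOp_le {t : ℝ} (ht : 0 < t) :
    ∃ C : ℝ≥0∞, C ≠ ⊤ ∧ ∀ F : HalfLine → ℝ≥0∞, Measurable F →
      ∫⁻ x, heatOp t F x ^ 2 ∂gam ≤ C * ∫⁻ x, F x ^ 2 ∂gam := by
  set A := ∫⁻ u, ENNReal.ofReal (schurProfile t u) with hA
  have hA1 : A ≠ ⊤ := lintegral_schurProfile_ne_top ht
  refine ⟨A * A, ENNReal.mul_ne_top hA1 hA1, fun F hF => ?_⟩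
  rw [lintegral_gam (by fun_prop), lintegral_gam (by fun_prop)]
  have h1 : ∀ x, weight x * heatOp t F x ^ 2 ≤
      A * ∫⁻ y, kernel t x y * (schurWeight y * F y ^ 2) ∂leb := fun x => by
    calc weight x * heatOp t F x ^ 2 ≤ 1 * heatOp t F x ^ 2 := by
          gcongr; exact weight_le_one x
      _ = heatOp t F x ^ 2 := one_mul _
      _ ≤ _ := sq_lintegral_mul_le (by fun_prop) measurable_schurWeight hF
          schurWeight_ne_zero schurWeight_ne_top
      _ ≤ _ := by
          gcongr; exact lintegral_kernel_mul_inv_schurWeight_le_right ht x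
  have h2 : ∀ y, ∫⁻ x, kernel t x y * (schurWeight y * F y ^ 2) ∂leb ≤
      A * (weight y * F y ^ 2) := fun y => by
    rw [lintegral_mul_const _ (by fun_prop)]
    calc _ ≤ A * schurWeight y * (schurWeight y * F y ^ 2) := by
          gcongr; exact lintegral_kernel_le ht y
      _ = A * (schurWeight y ^ 2 * F y ^ 2) := by ring
      _ ≤ _ := by gcongr; exact schurWeight_sq_le y
  have hm : Measurable fun q : HalfLine × HalfLine =>
      kernel t q.1 q.2 * (schurWeight q.2 * F q.2 ^ 2) := by fun_prop
  calc _ ≤ ∫⁻ x, A * ∫⁻ y, kernel t x y * (schurWeight y * F y ^ 2) ∂leb ∂leb :=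
        lintegral_mono h1
    _ = A * ∫⁻ x, ∫⁻ y, kernel t x y * (schurWeight y * F y ^ 2) ∂leb ∂leb :=
        lintegral_const_mul _ hm.lintegral_prod_right'
    _ = A * ∫⁻ y, ∫⁻ x, kernel t x y * (schurWeight y * F y ^ 2) ∂leb ∂leb := by
        rw [lintegral_lintegral_swap hm.aemeasurable]
    _ ≤ A * ∫⁻ y, A * (weight y * F y ^ 2) ∂leb := by
        gcongr with y; exact h2 y
    _ = _ := by
        rw [lintegral_const_mul _ (by have := measurable_weight; fun_prop), mul_assoc]

/-- The boundary kernels are square integrable, with a norm that is integrable in time. -/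
theorem lintegral_sq_boundaryFun_le {s : ℝ} (hs : 0 < s) :
    ∫⁻ y, boundaryFun s y ^ 2 ∂gam ≤ ENNReal.ofReal (8 * (Real.sqrt (2 * Real.pi * s))⁻¹) := by
  rw [lintegral_gam (by fun_prop)]
  set c := (Real.sqrt (2 * Real.pi * s))⁻¹ with hc
  have hc0 : 0 ≤ c := by positivity
  have h1 : ∀ y : HalfLine, weight y * boundaryFun s y ^ 2 ≤
      ENNReal.ofReal (8 * c * heatKernel s ((y : ℝ) - 0)) := fun y => by
    have hw : (0 : ℝ) ≤ 1 - Real.exp (-(y : ℝ) ^ 2) := by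
      have : Real.exp (-(y : ℝ) ^ 2) ≤ 1 := Real.exp_le_one_iff.2 (by simp; positivity)
      linarith
    unfold weight boundaryFun
    rw [← ENNReal.ofReal_pow (boundaryKernel_nonneg hs y.2), ← ENNReal.ofReal_mul hw]
    refine ENNReal.ofReal_le_ofReal ?_
    have hw2 : 1 - Real.exp (-(y : ℝ) ^ 2) ≤ (y : ℝ) ^ 2 := by
      linarith [Real.add_one_le_exp (-(y : ℝ) ^ 2)]
    set v := (y : ℝ) ^ 2 / (2 * s) with hv
    have hv0 : 0 ≤ v := by positivity
    have hy2 : (y : ℝ) ^ 2 = 2 * s * v := by rw [hv]; field_simp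
    have hk : heatKernel s y = c * Real.exp (-v) := by
      unfold heatKernel; rw [hv, neg_div]
    have hb : boundaryKernel s y ^ 2 = (y : ℝ) ^ 2 * (c * Real.exp (-v)) ^ 2 / s ^ 2 := by
      unfold boundaryKernel; rw [hk]; ring
    rw [sub_zero, hk, hb, hy2]
    rw [hy2] at hw2 hw
    have hexp : v ^ 2 / 2 * Real.exp (-v) ≤ 1 := by
      have h := Real.quadratic_le_exp_of_nonneg hv0
      have h2 : Real.exp v * Real.exp (-v) = 1 := by rw [← Real.exp_add]; simp
      have := Real.exp_pos (-v)
      nlinarith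
    calc (1 - Real.exp (-(2 * s * v))) * (2 * s * v * (c * Real.exp (-v)) ^ 2 / s ^ 2)
        ≤ (2 * s * v) * (2 * s * v * (c * Real.exp (-v)) ^ 2 / s ^ 2) := by gcongr
      _ = 8 * c * (c * Real.exp (-v)) * (v ^ 2 / 2 * Real.exp (-v)) := by field_simp; ring
      _ ≤ 8 * c * (c * Real.exp (-v)) * 1 := by gcongr
      _ = _ := mul_one _
  refine (lintegral_mono h1).trans ?_
  have hint := (integrable_heatKernel_sub hs 0).const_mul (8 * c)
  rw [lintegral_leb_ofReal hint.integrableOn fun y _ =>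
    mul_nonneg (by positivity) (heatKernel_nonneg _ _)]
  refine ENNReal.ofReal_le_ofReal ?_
  calc _ ≤ ∫ y, 8 * c * heatKernel s (y - 0) :=
        setIntegral_le_integral hint (Filter.Eventually.of_forall fun y =>
          mul_nonneg (by positivity) (heatKernel_nonneg _ _))
    _ = _ := by rw [integral_const_mul, integral_heatKernel_sub hs, mul_one]

/-- On non-negative elements of `L²(D, γ)` the two versions of the semigroup agree. In particular
`heatOp` takes finite values there. -/
theorem ofReal_semigroup (t : HalfLine) {f : H} (hf : 0 ≤ f) (x : HalfLine) :
    ENNReal.ofReal (semigroup t f x) = heatOp t (fun y => ENNReal.ofReal (f y)) x := by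
  have hf0 : ∀ᵐ y ∂leb, 0 ≤ f y :=
    leb_absolutelyContinuous_gam.ae_le ((Lp.coeFn_nonneg f).2 hf)
  unfold semigroup heatOp kernel
  rw [ofReal_integral_eq_lintegral_ofReal (integrable_transitionDensity_mul t x f)]
  · refine lintegral_congr fun y => ?_
    rw [ENNReal.ofReal_mul (transitionDensity_pos t.2 x.2 y.2).le]
  · filter_upwards [hf0] with y hy
    exact mul_nonneg (transitionDensity_pos t.2 x.2 y.2).le hy

theorem semigroup_nonneg (t : HalfLine) {f : H} (hf : 0 ≤ f) (x : HalfLine) :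
    0 ≤ semigroup t f x := by
  have hf0 : ∀ᵐ y ∂leb, 0 ≤ f y :=
    leb_absolutelyContinuous_gam.ae_le ((Lp.coeFn_nonneg f).2 hf)
  refine integral_nonneg_of_ae ?_
  filter_upwards [hf0] with y hy
  exact mul_nonneg (transitionDensity_pos t.2 x.2 y.2).le hy

/-- A square integrable function with values in `[0, ∞]` defines a non-negative element of
`L²(D, γ)`. -/
theorem exists_nonneg_ae_eq_of_lintegral_sq_ne_top {F : HalfLine → ℝ≥0∞} (hF : Measurable F)
    (h : ∫⁻ y, F y ^ 2 ∂gam ≠ ⊤) :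
    ∃ f : H, 0 ≤ f ∧ f =ᵐ[gam] (fun y => (F y).toReal) ∧
      (fun y => ENNReal.ofReal (f y)) =ᵐ[gam] F := by
  have hfin : ∀ᵐ y ∂gam, F y ≠ ⊤ := by
    filter_upwards [ae_lt_top (by fun_prop) h] with y hy hy'
    rw [hy'] at hy; simp at hy
  have hmem : MemLp (fun y => (F y).toReal) 2 gam := by
    rw [memLp_two_iff_integrable_sq hF.ennreal_toReal.aestronglyMeasurable]
    have := integrable_toReal_of_lintegral_ne_top (f := fun y => F y ^ 2) (by fun_prop) h
    simpa using this
  refine ⟨hmem.toLp, ?_, hmem.coeFn_toLp, ?_⟩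
  · rw [← Lp.coeFn_nonneg]
    filter_upwards [hmem.coeFn_toLp] with y hy
    rw [hy]; exact ENNReal.toReal_nonneg
  · filter_upwards [hmem.coeFn_toLp, hfin] with y hy hy'
    rw [hy, ENNReal.ofReal_toReal hy']

theorem heatOp_ne_top {t : ℝ} (ht : 0 < t) {F : HalfLine → ℝ≥0∞} (hF : Measurable F)
    (h : ∫⁻ y, F y ^ 2 ∂gam ≠ ⊤) (x : HalfLine) : heatOp t F x ≠ ⊤ := by
  obtain ⟨f, hf, -, hfF⟩ := exists_nonneg_ae_eq_of_lintegral_sq_ne_top hF h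
  rw [← heatOp_congr (leb_absolutelyContinuous_gam.ae_le hfF)]
  rw [← ofReal_semigroup ⟨t, ht⟩ hf]
  exact ENNReal.ofReal_ne_top

/-- The squared norm in `L²(D, γ)` as a Lebesgue integral. -/
theorem enorm_sq_eq_lintegral {f : H} (hf : 0 ≤ f) :
    ‖f‖ₑ ^ 2 = ∫⁻ y, ENNReal.ofReal (f y) ^ 2 ∂gam := by
  rw [Lp.enorm_def, eLpNorm_eq_lintegral_rpow_enorm_toReal (by norm_num) (by norm_num)]
  rw [← ENNReal.rpow_two, ← ENNReal.rpow_mul]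
  simp only [ENNReal.toReal_ofNat, one_div, ne_eq, OfNat.ofNat_ne_zero, not_false_eq_true,
    inv_mul_cancel₀, ENNReal.rpow_one, ENNReal.rpow_two]
  refine lintegral_congr_ae ?_
  filter_upwards [(Lp.coeFn_nonneg f).2 hf] with y hy
  rw [Real.enorm_of_nonneg hy]

/-! ### Paths represented by a pair `(a, μ)` -/

theorem leb_Iio_ne_zero (l : HalfLine) : leb (Set.Iio l) ≠ 0 := by
  unfold leb
  rw [measurableEmbedding_val.comap_apply]
  have h : Subtype.val '' Set.Iio l = Set.Ioo (0 : ℝ) l := by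
    ext x
    constructor
    · rintro ⟨z, hz, rfl⟩
      exact ⟨z.2, hz⟩
    · rintro ⟨h0, h1⟩
      exact ⟨⟨x, h0⟩, h1, rfl⟩
  rw [h, Real.volume_Ioo]
  have := l.2
  simpa using this

/-- No measurability of `G` is needed: were `G` infinite near `0`, so would be its integral. -/
theorem exists_lt_ne_top_of_setLIntegral_lt_top {G : HalfLine → ℝ≥0∞} {l : HalfLine}
    (h : ∫⁻ s in Set.Iio l, G s ∂leb < ⊤) (ε : HalfLine) : ∃ s < ε, G s ≠ ⊤ := by
  by_contra! hG
  refine h.ne (top_le_iff.1 ?_)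
  calc ⊤ = ∫⁻ _ in Set.Iio (min ε l), ⊤ ∂leb := by
        rw [setLIntegral_const, ENNReal.top_mul (leb_Iio_ne_zero _)]
    _ ≤ ∫⁻ s in Set.Iio (min ε l), G s ∂leb :=
        setLIntegral_mono' measurableSet_Iio fun s hs => (hG s (hs.trans_le (min_le_left _ _))).ge
    _ ≤ _ := lintegral_mono_set (Set.Iio_subset_Iio (min_le_right _ _))

theorem exists_potential_ne_top {μ : Measure HalfLine} {s : ℝ}
    (h : ∫⁻ y, potential μ s y ^ 2 ∂gam ≠ ⊤) : ∃ y, potential μ s y ≠ ⊤ := by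
  by_contra! hy
  refine h ?_
  simp only [hy, ne_eq, OfNat.ofNat_ne_zero, not_false_eq_true, ENNReal.top_pow]
  rw [lintegral_const, ENNReal.top_mul]
  simpa using gam_ne_zero

/-- A strictly positive function has a finite integral, so `μ` is σ-finite; this makes Tonelli's
theorem available. -/
theorem sFinite_of_potential_ne_top {μ : Measure HalfLine} {s : ℝ} (hs : 0 < s) {y : HalfLine}
    (h : potential μ s y ≠ ⊤) : SFinite μ := by
  have : IsFiniteMeasure (μ.withDensity fun z => kernel s z y) := isFiniteMeasure_withDensity h
  rw [← withDensity_inv_same (μ := μ) (f := fun z => kernel s z y) (by fun_prop)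
    (Filter.Eventually.of_forall fun z => kernel_ne_zero hs z y)
    (Filter.Eventually.of_forall fun z => kernel_ne_top s z y)]
  infer_instance

theorem mem_entranceMeasures {μ : Measure HalfLine} : μ ∈ entranceMeasures ↔
    ∃ l : HalfLine, ∫⁻ s in Set.Iio l, ∫⁻ y, potential μ (s : HalfLine) y ^ 2 ∂gam ∂leb < ⊤ :=
  Iff.rfl

theorem sFinite_of_mem_entranceMeasures {μ : Measure HalfLine} (hμ : μ ∈ entranceMeasures) :
    SFinite μ := by
  obtain ⟨l, hl⟩ := mem_entranceMeasures.1 hμ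
  obtain ⟨s, -, hs⟩ := exists_lt_ne_top_of_setLIntegral_lt_top hl l
  obtain ⟨y, hy⟩ := exists_potential_ne_top hs
  exact sFinite_of_potential_ne_top s.2 hy

/-- There are arbitrarily small times at which the potential is square integrable, and the semigroup
carries this to all later times. -/
theorem potential_of_mem_entranceMeasures {μ : Measure HalfLine} (hμ : μ ∈ entranceMeasures)
    (s : HalfLine) :
    ∫⁻ y, potential μ s y ^ 2 ∂gam ≠ ⊤ ∧ ∀ y, potential μ s y ≠ ⊤ := by
  have := sFinite_of_mem_entranceMeasures hμ
  obtain ⟨l, hl⟩ := mem_entranceMeasures.1 hμ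
  obtain ⟨r, hr, hr2⟩ := exists_lt_ne_top_of_setLIntegral_lt_top hl s
  have ht : 0 < (s : ℝ) - r := sub_pos.2 hr
  have e : potential μ s = heatOp (s - r) (potential μ r) := by
    rw [heatOp_potential r.2 ht, sub_add_cancel]
  obtain ⟨C, hC, hCF⟩ := exists_lintegral_sq_heatOp_le ht
  rw [e]
  exact ⟨ne_top_of_le_ne_top (ENNReal.mul_ne_top hC hr2) (hCF _ (measurable_potential μ r)),
    heatOp_ne_top ht (measurable_potential μ r) hr2⟩

theorem add_sq_le_two_mul (x y : ℝ≥0∞) : (x + y) ^ 2 ≤ 2 * (x ^ 2 + y ^ 2) := by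
  have h := ENNReal.rpow_add_le_mul_rpow_add_rpow x y (p := 2) (by norm_num)
  norm_num at h
  exact h

theorem setLIntegral_sq_boundaryFun_lt_top (l : HalfLine) :
    ∫⁻ s in Set.Iio l, ENNReal.ofReal (8 * (Real.sqrt (2 * Real.pi * s))⁻¹) ∂leb < ⊤ := by
  rw [← lintegral_indicator measurableSet_Iio]
  have e : ∀ s : HalfLine, (Set.Iio l).indicator
      (fun s : HalfLine => ENNReal.ofReal (8 * (Real.sqrt (2 * Real.pi * s))⁻¹)) s =
      (Set.Iio (l : ℝ)).indicator
        (fun s : ℝ => ENNReal.ofReal (8 * (Real.sqrt (2 * Real.pi * s))⁻¹)) s := fun s => rfl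
  simp only [e]
  rw [lintegral_leb, lintegral_indicator measurableSet_Iio, Measure.restrict_restrict
    measurableSet_Iio, Set.inter_comm, Set.Ioi_inter_Iio]
  refine IntegrableOn.setLIntegral_lt_top ?_
  have h := ((intervalIntegral.integrableOn_Ioo_rpow_iff (s := -(1 / 2)) l.2).2
    (by norm_num)).const_mul (8 * (Real.sqrt (2 * Real.pi))⁻¹)
  refine h.congr ((ae_restrict_mem measurableSet_Ioo).mono fun s hs => ?_)
  simp only
  rw [Real.sqrt_mul (x := 2 * Real.pi) (by positivity), Real.rpow_neg hs.1.le,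
    ← Real.sqrt_eq_rpow, mul_inv]
  ring

theorem potential_ne_top_iff {μ : Measure HalfLine} {s : ℝ} (hs : 0 < s) (y : HalfLine) :
    potential μ s y ≠ ⊤ ↔ Integrable (fun z : HalfLine => transitionDensity s z y) μ := by
  have hm : AEStronglyMeasurable (fun z : HalfLine => transitionDensity s z y) μ := by
    refine Measurable.aestronglyMeasurable ?_
    unfold transitionDensity heatKernel
    fun_prop
  exact lintegral_ofReal_ne_top_iff_integrable hm
    (Filter.Eventually.of_forall fun z => (transitionDensity_pos hs z.2 y.2).le)

/-- The representation, written with functions valued in `[0, ∞]`. -/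
theorem represents_iff {u : HalfLine → H} (hu : ∀ s, 0 ≤ u s) {a : ℝ} (ha : 0 ≤ a)
    {μ : Measure HalfLine} :
    Represents u a μ ↔ ∀ s : HalfLine, (∀ y, potential μ s y ≠ ⊤) ∧
      (fun y => ENNReal.ofReal (u s y)) =ᵐ[gam] entranceLaw (ENNReal.ofReal a) μ s := by
  refine forall_congr' fun s => ?_
  rw [forall_congr' fun y => potential_ne_top_iff s.2 y]
  refine and_congr_right fun hint => ?_
  have h0 : ∀ y : HalfLine, 0 ≤ a * boundaryKernel s y := fun y =>
    mul_nonneg ha (boundaryKernel_nonneg s.2 y.2)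
  have h1 : ∀ y : HalfLine, 0 ≤ ∫ z : HalfLine, transitionDensity s z y ∂μ := fun y =>
    integral_nonneg fun z => (transitionDensity_pos s.2 z.2 y.2).le
  have e : ∀ y : HalfLine, entranceLaw (ENNReal.ofReal a) μ s y =
      ENNReal.ofReal (a * boundaryKernel s y + ∫ z : HalfLine, transitionDensity s z y ∂μ) := by
    intro y
    rw [ENNReal.ofReal_add (h0 y) (h1 y), ENNReal.ofReal_mul ha,
      ofReal_integral_eq_lintegral_ofReal (hint y)
        (Filter.Eventually.of_forall fun z => (transitionDensity_pos s.2 z.2 y.2).le)]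
    rfl
  constructor
  · intro h
    filter_upwards [h] with y hy
    rw [hy, e]
  · intro h
    filter_upwards [h, (Lp.coeFn_nonneg _).2 (hu s)] with y hy hy0
    rw [e] at hy
    exact (ENNReal.ofReal_eq_ofReal_iff hy0 (add_nonneg (h0 y) (h1 y))).1 hy

/-- The entrance property, written with functions valued in `[0, ∞]`. -/
theorem isEntrancePath_iff {u : HalfLine → H} (hu : ∀ s, 0 ≤ u s) :
    IsEntrancePath u ↔ ∀ r t : HalfLine, (fun y => ENNReal.ofReal (u (r + t) y)) =ᵐ[leb]
      heatOp t fun y => ENNReal.ofReal (u r y) := by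
  refine forall_congr' fun r => forall_congr' fun t => ?_
  have h0 := (Lp.coeFn_nonneg _).2 (hu (r + t))
  constructor
  · intro h
    refine leb_absolutelyContinuous_gam.ae_le ?_
    filter_upwards [h] with y hy
    rw [hy, ofReal_semigroup t (hu r)]
  · intro h
    filter_upwards [h0, gam_absolutelyContinuous_leb.ae_le h] with y hy0 hy
    rw [← ofReal_semigroup t (hu r)] at hy
    exact (ENNReal.ofReal_eq_ofReal_iff hy0 (semigroup_nonneg t (hu r) y)).1 hy

/-- Every pair `(a, μ)` represents an element of the entrance space. -/
theorem exists_represents {a : ℝ} (ha : 0 ≤ a) {μ : Measure HalfLine}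
    (hμ : μ ∈ entranceMeasures) : ∃ u ∈ nonnegEntranceSpace, Represents u a μ := by
  have := sFinite_of_mem_entranceMeasures hμ
  obtain ⟨l, hl⟩ := mem_entranceMeasures.1 hμ
  set b := ENNReal.ofReal a with hb
  have hsq : ∀ s : HalfLine, ∫⁻ y, entranceLaw b μ s y ^ 2 ∂gam ≤
      2 * b ^ 2 * ENNReal.ofReal (8 * (Real.sqrt (2 * Real.pi * s))⁻¹) +
        2 * ∫⁻ y, potential μ s y ^ 2 ∂gam := fun s => by
    have h1 : ∀ y, entranceLaw b μ s y ^ 2 ≤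
        2 * b ^ 2 * boundaryFun s y ^ 2 + 2 * potential μ s y ^ 2 := fun y => by
      unfold entranceLaw
      exact (add_sq_le_two_mul _ _).trans_eq (by ring)
    refine (lintegral_mono h1).trans ?_
    rw [lintegral_add_left (by fun_prop), lintegral_const_mul _ (by fun_prop),
      lintegral_const_mul _ (by fun_prop)]
    gcongr
    exact lintegral_sq_boundaryFun_le s.2
  have hfin : ∀ s : HalfLine, ∫⁻ y, entranceLaw b μ s y ^ 2 ∂gam ≠ ⊤ := fun s => by
    refine ne_top_of_le_ne_top ?_ (hsq s)
    have := (potential_of_mem_entranceMeasures hμ s).1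
    finiteness
  choose u hu0 _ hu2 using fun s : HalfLine => exists_nonneg_ae_eq_of_lintegral_sq_ne_top
    (measurable_entranceLaw b μ s) (hfin s)
  refine ⟨u, ⟨⟨?_, l, ?_⟩, hu0⟩, ?_⟩
  · rw [isEntrancePath_iff hu0]
    intro r t
    rw [heatOp_congr (leb_absolutelyContinuous_gam.ae_le (hu2 r)), heatOp_entranceLaw r.2 t.2,
      add_comm (t : ℝ) r]
    exact leb_absolutelyContinuous_gam.ae_le (hu2 (r + t))
  · have e : ∀ s, ‖u s‖ₑ ^ 2 ≤
        2 * b ^ 2 * ENNReal.ofReal (8 * (Real.sqrt (2 * Real.pi * s))⁻¹) +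
          2 * ∫⁻ y, potential μ s y ^ 2 ∂gam := fun s => by
      rw [enorm_sq_eq_lintegral (hu0 s)]
      refine (le_of_eq ?_).trans (hsq s)
      exact lintegral_congr_ae ((hu2 s).mono fun y hy => by simp only [hy])
    refine (lintegral_mono e).trans_lt ?_
    rw [lintegral_add_left (by fun_prop), lintegral_const_mul _ (by fun_prop),
      lintegral_const_mul' _ _ (by finiteness)]
    have := setLIntegral_sq_boundaryFun_lt_top l
    finiteness
  · rw [represents_iff hu0 ha]
    exact fun s => ⟨(potential_of_mem_entranceMeasures hμ s).2, hu2 s⟩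

/-! ### Uniqueness of the representing pair -/

/-- A finite measure on `ℝ` is determined by its two-sided Laplace transform, if that is finite. -/
theorem measure_ext_of_lintegral_exp {ρ ρ' : Measure ℝ}
    (hfin : ∀ y : ℝ, ∫⁻ x, ENNReal.ofReal (Real.exp (y * x)) ∂ρ ≠ ⊤)
    (h : ∀ y : ℝ, ∫⁻ x, ENNReal.ofReal (Real.exp (y * x)) ∂ρ =
      ∫⁻ x, ENNReal.ofReal (Real.exp (y * x)) ∂ρ') : ρ = ρ' := by
  have huniv : ρ Set.univ = ρ' Set.univ := by simpa using h 0
  have hf : IsFiniteMeasure ρ := ⟨by simpa [lt_top_iff_ne_top] using hfin 0⟩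
  have hf' : IsFiniteMeasure ρ' := ⟨by rw [← huniv]; exact hf.1⟩
  have hint : ProbabilityTheory.integrableExpSet id ρ = Set.univ := by
    ext y
    simp only [ProbabilityTheory.integrableExpSet, Set.mem_univ, iff_true]
    exact (lintegral_ofReal_ne_top_iff_integrable (by fun_prop)
      (Filter.Eventually.of_forall fun x => (Real.exp_pos _).le)).1 (hfin y)
  have hmgf : ProbabilityTheory.mgf id ρ = ProbabilityTheory.mgf id ρ' := by
    ext y
    unfold ProbabilityTheory.mgf
    rw [integral_eq_lintegral_of_nonneg_ae
        (Filter.Eventually.of_forall fun x => (Real.exp_pos _).le) (by fun_prop),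
      integral_eq_lintegral_of_nonneg_ae
        (Filter.Eventually.of_forall fun x => (Real.exp_pos _).le) (by fun_prop)]
    exact congrArg ENNReal.toReal (h y)
  have h0 : ρ = 0 ↔ ρ' = 0 := by
    rw [← Measure.measure_univ_eq_zero, huniv, Measure.measure_univ_eq_zero]
  refine Measure.ext_of_complexMGF_id_eq ?_
  ext z
  refine ProbabilityTheory.eqOn_complexMGF_of_mgf' hmgf h0 ?_
  simp [hint]

/-- The measure `a δ₀` plus the reflection-symmetric extension of `ν` to the line. -/
def symmetrization (a : ℝ≥0∞) (ν : Measure HalfLine) : Measure ℝ :=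
  a • Measure.dirac 0 + (ν.map Subtype.val + ν.map fun z : HalfLine => -(z : ℝ))

theorem symmetrization_injective {a a' : ℝ≥0∞} {ν ν' : Measure HalfLine}
    (h : symmetrization a ν = symmetrization a' ν') : a = a' ∧ ν = ν' := by
  have hm : Measurable fun z : HalfLine => -(z : ℝ) := by fun_prop
  have h0 : ∀ (a : ℝ≥0∞) (ν : Measure HalfLine), symmetrization a ν {0} = a := by
    intro a ν
    have e1 : (Subtype.val : HalfLine → ℝ) ⁻¹' {0} = ∅ := by
      ext z; simpa using z.2.ne'
    have e2 : (fun z : HalfLine => -(z : ℝ)) ⁻¹' {0} = ∅ := by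
      ext z; simpa using z.2.ne'
    simp only [symmetrization, Measure.add_apply, Measure.smul_apply,
      Measure.map_apply measurableEmbedding_val.measurable (measurableSet_singleton 0),
      Measure.map_apply hm (measurableSet_singleton 0)]
    rw [e1, e2]
    simp
  have h1 : ∀ (a : ℝ≥0∞) (ν : Measure HalfLine) {S : Set HalfLine}, MeasurableSet S →
      symmetrization a ν (Subtype.val '' S) = ν S := by
    intro a ν S hS
    have hS' := measurableEmbedding_val.measurableSet_image.2 hS
    have e1 : (Subtype.val : HalfLine → ℝ) ⁻¹' (Subtype.val '' S) = S :=
      Set.preimage_image_eq _ Subtype.val_injective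
    have e2 : (fun z : HalfLine => -(z : ℝ)) ⁻¹' (Subtype.val '' S) = ∅ := by
      ext z
      simp only [Set.mem_preimage, Set.mem_image, Set.mem_empty_iff_false, iff_false]
      rintro ⟨w, -, hw⟩
      have := w.2
      have := z.2
      linarith
    have e3 : (0 : ℝ) ∉ Subtype.val '' S := by
      rintro ⟨w, -, hw⟩
      exact w.2.ne' hw
    simp only [symmetrization, Measure.add_apply, Measure.smul_apply,
      Measure.map_apply measurableEmbedding_val.measurable hS', Measure.map_apply hm hS']
    rw [e1, e2, Measure.dirac_apply' _ hS']
    simp [e3]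
  refine ⟨?_, Measure.ext fun S hS => ?_⟩
  · rw [← h0 a ν, h, h0]
  · rw [← h1 a ν hS, h, h1 _ _ hS]

/-- The density `e^{-z²/2} sinh z`. It vanishes to first order at `0`, so that multiplying `μ` by it
gives a finite measure, with all exponential moments. -/
def sinhWeight (z : HalfLine) : ℝ≥0∞ :=
  ENNReal.ofReal (Real.exp (-(z : ℝ) ^ 2 / 2) * Real.sinh z)

@[fun_prop]
theorem measurable_sinhWeight : Measurable sinhWeight := by
  unfold sinhWeight; fun_prop

theorem sinhWeight_ne_zero (z : HalfLine) : sinhWeight z ≠ 0 := by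
  have := Real.sinh_pos_iff.2 z.2
  rw [sinhWeight, ne_eq, ENNReal.ofReal_eq_zero, not_le]
  positivity

theorem transitionDensity_one_eq (z y : ℝ) : transitionDensity 1 z y =
    2 * heatKernel 1 y * (Real.exp (-z ^ 2 / 2) * Real.sinh (y * z)) := by
  rw [transitionDensity_eq_sinh one_pos]
  simp

/-- The hyperbolic sine transform of `μ`, proportional to the potential of `μ` at time `1`. -/
def sinhTransform (μ : Measure HalfLine) (y : ℝ) : ℝ :=
  ∫ z : HalfLine, Real.exp (-(z : ℝ) ^ 2 / 2) * Real.sinh (y * z) ∂μ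

theorem integrable_sinh {μ : Measure HalfLine} (h : ∀ y, potential μ 1 y ≠ ⊤) (y : ℝ) :
    Integrable (fun z : HalfLine => Real.exp (-(z : ℝ) ^ 2 / 2) * Real.sinh (y * z)) μ := by
  have key : ∀ y : ℝ, 0 < y → Integrable
      (fun z : HalfLine => Real.exp (-(z : ℝ) ^ 2 / 2) * Real.sinh (y * z)) μ := by
    intro y hy
    have h1 := (potential_ne_top_iff one_pos ⟨y, hy⟩).1 (h ⟨y, hy⟩)
    have hg := heatKernel_pos one_pos y
    refine (h1.const_mul (2 * heatKernel 1 y)⁻¹).congr (Filter.Eventually.of_forall fun z => ?_)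
    simp only [transitionDensity_one_eq]
    field_simp
  rcases lt_trichotomy y 0 with hy | hy | hy
  · refine (key (-y) (neg_pos.2 hy)).neg.congr (Filter.Eventually.of_forall fun z => ?_)
    simp [Real.sinh_neg]
  · simp [hy]
  · exact key y hy

theorem sinhTransform_neg (μ : Measure HalfLine) (y : ℝ) :
    sinhTransform μ (-y) = -sinhTransform μ y := by
  simp only [sinhTransform, neg_mul, Real.sinh_neg, mul_neg, integral_neg]

theorem entranceLaw_one_eq {a : ℝ} (ha : 0 ≤ a) {μ : Measure HalfLine}
    (h : ∀ y, potential μ 1 y ≠ ⊤) (y : HalfLine) :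
    entranceLaw (ENNReal.ofReal a) μ 1 y =
      ENNReal.ofReal (heatKernel 1 y * (a * y + 2 * sinhTransform μ y)) := by
  have hy := y.2
  have hg := heatKernel_pos one_pos y
  have h1 := (potential_ne_top_iff one_pos y).1 (h y)
  have h0 : 0 ≤ sinhTransform μ y := integral_nonneg fun z => by
    have := (Real.sinh_pos_iff.2 (mul_pos hy z.2)).le
    positivity
  have e : potential μ 1 y = ENNReal.ofReal (2 * heatKernel 1 y * sinhTransform μ y) := by
    unfold potential kernel sinhTransform
    rw [← ofReal_integral_eq_lintegral_ofReal h1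
      (Filter.Eventually.of_forall fun z => (transitionDensity_pos one_pos z.2 y.2).le),
      ← integral_const_mul]
    simp only [transitionDensity_one_eq]
  unfold entranceLaw boundaryFun boundaryKernel
  rw [e, ← ENNReal.ofReal_mul ha, ← ENNReal.ofReal_add (by positivity) (by positivity)]
  congr 1
  ring

/-- The Laplace transform of the symmetrized measure is a difference of values of the function
`a y + 2 ∫ e^{-z²/2} sinh (y z) μ(dz)`, because
`sinh ((y + 1) z) - sinh ((y - 1) z) = 2 cosh (y z) sinh z`. -/
theorem lintegral_exp_symmetrization {a : ℝ} (ha : 0 ≤ a) {μ : Measure HalfLine}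
    (h : ∀ y, potential μ 1 y ≠ ⊤) (y : ℝ) :
    ∫⁻ x, ENNReal.ofReal (Real.exp (y * x))
        ∂symmetrization (ENNReal.ofReal a) (μ.withDensity sinhWeight) =
      ENNReal.ofReal (2⁻¹ * ((a * (y + 1) + 2 * sinhTransform μ (y + 1)) -
        (a * (y - 1) + 2 * sinhTransform μ (y - 1)))) := by
  have hm : Measurable fun z : HalfLine => -(z : ℝ) := by fun_prop
  have hi := (integrable_sinh h (y + 1)).sub (integrable_sinh h (y - 1))
  have e : ∀ z : HalfLine, sinhWeight z * ENNReal.ofReal (Real.exp (y * z)) +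
      sinhWeight z * ENNReal.ofReal (Real.exp (y * -z)) =
      ENNReal.ofReal (Real.exp (-(z : ℝ) ^ 2 / 2) * Real.sinh ((y + 1) * z) -
        Real.exp (-(z : ℝ) ^ 2 / 2) * Real.sinh ((y - 1) * z)) := by
    intro z
    have hz := Real.sinh_pos_iff.2 z.2
    unfold sinhWeight
    rw [← mul_add, ← ENNReal.ofReal_add (by positivity) (by positivity),
      ← ENNReal.ofReal_mul (by positivity), add_mul, sub_mul, one_mul, Real.sinh_add,
      Real.sinh_sub, Real.cosh_eq (y * z), mul_neg]
    congr 1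
    ring
  have hnn : ∀ z : HalfLine, 0 ≤ Real.exp (-(z : ℝ) ^ 2 / 2) * Real.sinh ((y + 1) * z) -
        Real.exp (-(z : ℝ) ^ 2 / 2) * Real.sinh ((y - 1) * z) := by
    intro z
    rw [← mul_sub]
    refine mul_nonneg (Real.exp_pos _).le (sub_nonneg.2 (Real.sinh_le_sinh.2 ?_))
    have := z.2
    nlinarith
  unfold symmetrization
  rw [lintegral_add_measure, lintegral_add_measure, lintegral_smul_measure,
    lintegral_dirac' _ (by fun_prop), lintegral_map (by fun_prop) measurable_subtype_coe,
    lintegral_map (by fun_prop) hm,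
    lintegral_withDensity_eq_lintegral_mul _ measurable_sinhWeight (by fun_prop),
    lintegral_withDensity_eq_lintegral_mul _ measurable_sinhWeight (by fun_prop),
    ← lintegral_add_left (by fun_prop)]
  simp only [Pi.mul_apply, e]
  have hI := ofReal_integral_eq_lintegral_ofReal hi (Filter.Eventually.of_forall hnn)
  simp only [Pi.sub_apply] at hI
  rw [← hI, integral_sub (integrable_sinh h (y + 1)) (integrable_sinh h (y - 1))]
  change _ + ENNReal.ofReal (sinhTransform μ (y + 1) - sinhTransform μ (y - 1)) = _
  have h0 : 0 ≤ sinhTransform μ (y + 1) - sinhTransform μ (y - 1) := by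
    unfold sinhTransform
    rw [← integral_sub (integrable_sinh h (y + 1)) (integrable_sinh h (y - 1))]
    exact integral_nonneg hnn
  simp only [mul_zero, Real.exp_zero, ENNReal.ofReal_one, smul_eq_mul, mul_one]
  rw [← ENNReal.ofReal_add ha h0]
  congr 1
  ring

/-- The pair `(a, μ)` is determined by the entrance law at a single time. -/
theorem entranceLaw_injective {a a' : ℝ} (ha : 0 ≤ a) (ha' : 0 ≤ a') {μ μ' : Measure HalfLine}
    (h : ∀ y, potential μ 1 y ≠ ⊤) (h' : ∀ y, potential μ' 1 y ≠ ⊤)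
    (heq : ∀ y, entranceLaw (ENNReal.ofReal a) μ 1 y = entranceLaw (ENNReal.ofReal a') μ' 1 y) :
    a = a' ∧ μ = μ' := by
  have hpos : ∀ y : ℝ, 0 < y →
      a * y + 2 * sinhTransform μ y = a' * y + 2 * sinhTransform μ' y := by
    intro y hy
    have h1 := heq ⟨y, hy⟩
    have hg := heatKernel_pos one_pos y
    have hS : ∀ μ : Measure HalfLine, 0 ≤ sinhTransform μ y := fun μ => integral_nonneg fun z => by
      have := (Real.sinh_pos_iff.2 (mul_pos hy z.2)).le
      positivity
    have := hS μ
    have := hS μ'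
    rw [entranceLaw_one_eq ha h, entranceLaw_one_eq ha' h',
      ENNReal.ofReal_eq_ofReal_iff (by positivity) (by positivity)] at h1
    exact mul_left_cancel₀ hg.ne' h1
  have hall : ∀ y : ℝ, a * y + 2 * sinhTransform μ y = a' * y + 2 * sinhTransform μ' y := by
    intro y
    rcases lt_trichotomy y 0 with hy | hy | hy
    · have := hpos (-y) (neg_pos.2 hy)
      rw [sinhTransform_neg, sinhTransform_neg] at this
      linarith
    · simp [hy, sinhTransform]
    · exact hpos y hy
  have hsymm : symmetrization (ENNReal.ofReal a) (μ.withDensity sinhWeight) =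
      symmetrization (ENNReal.ofReal a') (μ'.withDensity sinhWeight) := by
    refine measure_ext_of_lintegral_exp (fun y => ?_) fun y => ?_
    · rw [lintegral_exp_symmetrization ha h]
      exact ENNReal.ofReal_ne_top
    · rw [lintegral_exp_symmetrization ha h, lintegral_exp_symmetrization ha' h', hall, hall]
  obtain ⟨h1, h2⟩ := symmetrization_injective hsymm
  refine ⟨(ENNReal.ofReal_eq_ofReal_iff ha ha').1 h1, ?_⟩
  have hinv : ∀ μ : Measure HalfLine,
      ((μ.withDensity sinhWeight).withDensity fun z => (sinhWeight z)⁻¹) = μ := fun μ =>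
    withDensity_inv_same measurable_sinhWeight (Filter.Eventually.of_forall sinhWeight_ne_zero)
      (Filter.Eventually.of_forall fun z => ENNReal.ofReal_ne_top)
  rw [← hinv μ, h2, hinv]

theorem represents_unique {u : HalfLine → H} (hu : ∀ s, 0 ≤ u s) {a a' : ℝ} (ha : 0 ≤ a)
    (ha' : 0 ≤ a') {μ μ' : Measure HalfLine} (h : Represents u a μ) (h' : Represents u a' μ') :
    a = a' ∧ μ = μ' := by
  rw [represents_iff hu ha] at h
  rw [represents_iff hu ha'] at h'
  have hh : (0 : ℝ) < 1 / 2 := by norm_num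
  have : SFinite μ := sFinite_of_potential_ne_top one_pos ((h ⟨1, one_pos⟩).1 ⟨1, one_pos⟩)
  have : SFinite μ' := sFinite_of_potential_ne_top one_pos ((h' ⟨1, one_pos⟩).1 ⟨1, one_pos⟩)
  -- the laws agree almost everywhere at time `1/2`, hence everywhere at time `1`
  have e : entranceLaw (ENNReal.ofReal a) μ (1 / 2) =ᵐ[leb]
      entranceLaw (ENNReal.ofReal a') μ' (1 / 2) :=
    leb_absolutelyContinuous_gam.ae_le ((h ⟨1 / 2, hh⟩).2.symm.trans (h' ⟨1 / 2, hh⟩).2)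
  have e1 := heatOp_congr (t := 1 / 2) e
  rw [heatOp_entranceLaw hh hh, heatOp_entranceLaw hh hh, add_halves] at e1
  exact entranceLaw_injective ha ha' (h ⟨1, one_pos⟩).1 (h' ⟨1, one_pos⟩).1 (congrFun e1)

/-! ### Entrance laws and compactness at time zero -/

/-- An entrance law for the absorbed semigroup, with values in `[0, ∞]`, on which the semigroup
takes finite values. -/
structure IsEntranceLaw (F : HalfLine → HalfLine → ℝ≥0∞) : Prop where
  measurable : ∀ r, Measurable (F r)
  ae_eq : ∀ r t : HalfLine, F (r + t) =ᵐ[leb] heatOp t (F r)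
  heatOp_ne_top : ∀ (r t x : HalfLine), heatOp t (F r) x ≠ ⊤

namespace IsEntranceLaw

variable {F : HalfLine → HalfLine → ℝ≥0∞}

/-- The pointwise defined version `T_t F_r` of `F_{r+t}` depends on `r + t` only. -/
theorem heatOp_eq_heatOp (hF : IsEntranceLaw F) {r t r' t' : HalfLine} (h : r + t = r' + t') :
    heatOp t (F r) = heatOp t' (F r') := by
  have key : ∀ {r t r' t' : HalfLine}, r + t = r' + t' → r < r' →
      heatOp t (F r) = heatOp t' (F r') := by
    intro r t r' t' h hlt
    have he : (0 : ℝ) < r' - r := sub_pos.2 hlt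
    have hr : r' = r + (⟨r' - r, he⟩ : HalfLine) := Subtype.ext (by simp)
    have hval : (r : ℝ) + t = r' + t' := congrArg Subtype.val h
    have ht : (t : ℝ) = t' + (r' - r) := by linarith
    have h1 := hF.ae_eq r ⟨r' - r, he⟩
    rw [← hr] at h1
    rw [heatOp_congr h1, heatOp_heatOp he t'.2 (hF.measurable r), ht]
  rcases lt_trichotomy r r' with hlt | heq | hgt
  · exact key h hlt
  · subst heq
    rw [add_left_cancel h]
  · exact (key h.symm hgt).symm

end IsEntranceLaw

theorem kernel_le_mul {σ t : ℝ} (hσ : 0 < σ) (h : σ ≤ t) (x y : HalfLine) :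
    kernel σ x y ≤ ENNReal.ofReal ((t / σ) ^ 2) * kernel t x y := by
  unfold kernel
  rw [← ENNReal.ofReal_mul (by positivity)]
  exact ENNReal.ofReal_le_ofReal (transitionDensity_le_mul hσ h x.2 y.2)

theorem heatOp_le_mul {σ t : ℝ} (hσ : 0 < σ) (h : σ ≤ t) {F : HalfLine → ℝ≥0∞}
    (hF : Measurable F) (x : HalfLine) :
    heatOp σ F x ≤ ENNReal.ofReal ((t / σ) ^ 2) * heatOp t F x := by
  unfold heatOp
  rw [← lintegral_const_mul _ (by fun_prop)]
  refine lintegral_mono fun y => ?_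
  rw [← mul_assoc]
  gcongr
  exact kernel_le_mul hσ h x y

/-- Right continuity in time of the semigroup, by domination by a later transition density. -/
theorem tendsto_heatOp_add {t : ℝ} (ht : 0 < t) {F : HalfLine → ℝ≥0∞} (hF : Measurable F)
    {s : ℕ → ℝ} (hs0 : ∀ n, 0 < s n) (hs1 : ∀ n, s n ≤ 1) (hs : Tendsto s atTop (𝓝 0))
    {x : HalfLine} (hfin : heatOp (t + 1) F x ≠ ⊤) :
    Tendsto (fun n => heatOp (t + s n) F x) atTop (𝓝 (heatOp t F x)) := by
  refine tendsto_lintegral_filter_of_dominated_convergence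
    (fun y => ENNReal.ofReal (((t + 1) / t) ^ 2) * (kernel (t + 1) x y * F y))
    (Eventually.of_forall fun n => by fun_prop) (Eventually.of_forall fun n =>
      Eventually.of_forall fun y => ?_) ?_ (Eventually.of_forall fun y => ?_)
  · have hsn := hs0 n
    have h1 := kernel_le_mul (by linarith) (by linarith [hs1 n] : t + s n ≤ t + 1) x y
    rw [← mul_assoc]
    gcongr
    refine h1.trans ?_
    gcongr
    linarith
  · rw [lintegral_const_mul _ (by fun_prop)]
    exact ENNReal.mul_ne_top ENNReal.ofReal_ne_top hfin
  · have hc : ContinuousAt (fun σ : ℝ => transitionDensity σ x y) t := by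
      unfold transitionDensity heatKernel
      have h2 : Real.sqrt (2 * Real.pi * t) ≠ 0 := by positivity
      have h3 : 2 * t ≠ 0 := by positivity
      fun_prop (disch := assumption)
    have hlim : Tendsto (fun n => t + s n) atTop (𝓝 t) := by
      simpa using hs.const_add t
    have hk : Tendsto (fun n => kernel (t + s n) x y) atTop (𝓝 (kernel t x y)) :=
      ENNReal.tendsto_ofReal (hc.tendsto.comp hlim)
    exact ENNReal.Tendsto.mul_const hk (Or.inl (kernel_ne_zero ht x y))

/-- The reference function `x e^{-x²/(2τ)}`, comparable to `p_τ(x, y)` near `x = 0`, and smaller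
than it at infinity. -/
def refFun (τ : ℝ) (x : HalfLine) : ℝ≥0∞ :=
  ENNReal.ofReal ((x : ℝ) * Real.exp (-(x : ℝ) ^ 2 / (2 * τ)))

@[fun_prop]
theorem measurable_refFun (τ : ℝ) : Measurable (refFun τ) := by
  unfold refFun; fun_prop

theorem refFun_ne_zero (τ : ℝ) (x : HalfLine) : refFun τ x ≠ 0 := by
  have := x.2
  rw [refFun, ne_eq, ENNReal.ofReal_eq_zero, not_le]
  positivity

theorem refFun_ne_top (τ : ℝ) (x : HalfLine) : refFun τ x ≠ ⊤ := ENNReal.ofReal_ne_top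

theorem refFun_le {τ : ℝ} (hτ : 0 < τ) (x : HalfLine) :
    refFun τ x ≤ ENNReal.ofReal (τ / (2 * heatKernel τ 1)) * kernel τ ⟨1, one_pos⟩ x := by
  have hx := x.2
  have hg := heatKernel_pos hτ 1
  unfold refFun kernel
  rw [← ENNReal.ofReal_mul (by positivity), transitionDensity_symm, transitionDensity_eq_sinh hτ]
  refine ENNReal.ofReal_le_ofReal ?_
  have h : 1 / τ * (x : ℝ) ≤ Real.sinh (1 / τ * x) := Real.self_le_sinh_iff.2 (by positivity)
  calc (x : ℝ) * Real.exp (-(x : ℝ) ^ 2 / (2 * τ))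
      = τ / (2 * heatKernel τ 1) * (2 * heatKernel τ 1 *
        (Real.exp (-(x : ℝ) ^ 2 / (2 * τ)) * (1 / τ * x))) := by field_simp
    _ ≤ _ := by gcongr

/-- The masses `∫ x e^{-x²/(2τ)} F_s(x) dx` stay bounded as `s → 0`, since `T_τ F_s(1)` does. -/
theorem IsEntranceLaw.exists_lintegral_refFun_le {F : HalfLine → HalfLine → ℝ≥0∞}
    (hF : IsEntranceLaw F) {τ : ℝ} (hτ : 0 < τ) :
    ∃ C : ℝ≥0, ∀ s : HalfLine, (s : ℝ) ≤ 1 → ∫⁻ x, refFun τ x * F s x ∂leb ≤ C := by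
  set o : HalfLine := ⟨1, one_pos⟩
  set h : HalfLine := ⟨τ / 2, half_pos hτ⟩
  set C : ℝ≥0∞ := ENNReal.ofReal (τ / (2 * heatKernel τ 1)) *
    (ENNReal.ofReal (((τ / 2 + 1) / (τ / 2)) ^ 2) * heatOp (τ / 2 + 1) (F h) o) with hC
  have hCfin : C ≠ ⊤ := by
    have := hF.heatOp_ne_top h (h + o) o
    refine ENNReal.mul_ne_top ENNReal.ofReal_ne_top
      (ENNReal.mul_ne_top ENNReal.ofReal_ne_top this)
  refine ⟨C.toNNReal, fun s hs => ?_⟩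
  rw [ENNReal.coe_toNNReal hCfin]
  have hm := hF.measurable s
  have hs0 := s.2
  have e : heatOp τ (F s) = heatOp (h + s : HalfLine) (F h) :=
    hF.heatOp_eq_heatOp (t := ⟨τ, hτ⟩) (Subtype.ext (by simp [h]; ring))
  calc ∫⁻ x, refFun τ x * F s x ∂leb
      ≤ ∫⁻ x, ENNReal.ofReal (τ / (2 * heatKernel τ 1)) * (kernel τ o x * F s x) ∂leb := by
        refine lintegral_mono fun x => ?_
        rw [← mul_assoc]
        gcongr
        exact refFun_le hτ x
    _ = ENNReal.ofReal (τ / (2 * heatKernel τ 1)) * heatOp τ (F s) o :=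
        lintegral_const_mul _ (by fun_prop)
    _ ≤ _ := by
        rw [hC, e]
        gcongr
        have h1 := heatOp_le_mul (σ := (h + s : HalfLine)) (t := τ / 2 + 1) (h + s).2
          (by simp [h, hs]) (hF.measurable h) o
        refine h1.trans ?_
        have h2 : τ / 2 ≤ (h + s : HalfLine) := by simp [h, hs0.le]
        have h3 : (0 : ℝ) < (h + s : HalfLine) := (h + s).2
        gcongr

theorem refFun_one_le {x : HalfLine} {R : ℝ} (hR : 0 ≤ R) (hx : R ≤ x) :
    refFun 1 x ≤ ENNReal.ofReal (Real.exp (-(R ^ 2 / 4))) * refFun 2 x := by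
  have hx0 := x.2
  unfold refFun
  rw [← ENNReal.ofReal_mul (Real.exp_pos _).le]
  refine ENNReal.ofReal_le_ofReal ?_
  have h1 : Real.exp (-(x : ℝ) ^ 2 / (2 * 1)) ≤
      Real.exp (-(R ^ 2 / 4)) * Real.exp (-(x : ℝ) ^ 2 / (2 * 2)) := by
    rw [← Real.exp_add]
    refine Real.exp_le_exp.2 ?_
    nlinarith [pow_le_pow_left₀ hR hx 2]
  calc _ ≤ (x : ℝ) * (Real.exp (-(R ^ 2 / 4)) * Real.exp (-(x : ℝ) ^ 2 / (2 * 2))) := by gcongr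
    _ = _ := by ring

/-- The inclusion of `(0, ∞)` into `[0, ∞)`. -/
def toNNReal (x : HalfLine) : ℝ≥0 := ⟨x, x.2.le⟩

@[fun_prop]
theorem measurable_toNNReal : Measurable toNNReal := by
  unfold toNNReal; fun_prop

/-- The measure `x e^{-x²/2} F(x) dx` on `[0, ∞)`, where mass may accumulate at `0`. -/
def refMeasure (F : HalfLine → ℝ≥0∞) : Measure ℝ≥0 :=
  (leb.withDensity fun x => refFun 1 x * F x).map toNNReal

theorem lintegral_refMeasure {F : HalfLine → ℝ≥0∞} (hF : Measurable F) {f : ℝ≥0 → ℝ≥0∞}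
    (hf : Measurable f) :
    ∫⁻ x, f x ∂refMeasure F = ∫⁻ x, refFun 1 x * F x * f (toNNReal x) ∂leb := by
  unfold refMeasure
  rw [lintegral_map hf measurable_toNNReal,
    lintegral_withDensity_eq_lintegral_mul _ (by fun_prop) (by fun_prop)]
  rfl

/-- Prokhorov compactness: the measures `x e^{-x²/2} F_s(x) dx` have a weak limit point on
`[0, ∞)` as `s → 0`. -/
theorem IsEntranceLaw.exists_limit {F : HalfLine → HalfLine → ℝ≥0∞} (hF : IsEntranceLaw F)
    {s : ℕ → HalfLine} (hs : ∀ n, (s n : ℝ) ≤ 1) :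
    ∃ η : Measure ℝ≥0, IsFiniteMeasure η ∧ ∀ f : BoundedContinuousFunction ℝ≥0 ℝ≥0,
      Tendsto (fun n => ∫⁻ x, f x ∂refMeasure (F (s n))) (hyperfilter ℕ) (𝓝 (∫⁻ x, f x ∂η)) := by
  obtain ⟨C₁, hC₁⟩ := hF.exists_lintegral_refFun_le one_pos
  obtain ⟨C₂, hC₂⟩ := hF.exists_lintegral_refFun_le two_pos
  have hmass : ∀ n, refMeasure (F (s n)) Set.univ ≤ C₁ := fun n => by
    have h := lintegral_refMeasure (hF.measurable (s n)) (f := fun _ => 1) measurable_const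
    simp only [lintegral_const, one_mul, mul_one] at h
    rw [h]
    exact hC₁ _ (hs n)
  have hfin : ∀ n, IsFiniteMeasure (refMeasure (F (s n))) := fun n =>
    ⟨(hmass n).trans_lt ENNReal.coe_lt_top⟩
  set ν : ℕ → FiniteMeasure ℝ≥0 := fun n => ⟨refMeasure (F (s n)), hfin n⟩ with hν
  set v : ℕ → ℝ≥0 := fun n => Real.toNNReal (Real.exp (-((n : ℝ) ^ 2 / 4))) * C₂ with hv
  have hv0 : Tendsto v atTop (𝓝 0) := by
    have h1 : Tendsto (fun n : ℕ => (n : ℝ) ^ 2 / 4) atTop atTop :=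
      ((tendsto_pow_atTop two_ne_zero).comp tendsto_natCast_atTop_atTop).atTop_div_const
        (by norm_num)
    have h2 := (Real.tendsto_exp_neg_atTop_nhds_zero.comp h1)
    have h3 := ((tendsto_real_toNNReal h2).mul_const C₂)
    simpa using h3
  have hcompact := isCompact_setOfPred_finiteMeasure_mass_le_compl_isCompact_le (E := ℝ≥0) C₁ hv0
    (K := fun n => Set.Icc 0 (n : ℝ≥0)) (fun n => isCompact_Icc) (Or.inl inferInstance)
  have hmem : ∀ n, ν n ∈ {μ : FiniteMeasure ℝ≥0 | μ.mass ≤ C₁ ∧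
      ∀ k : ℕ, μ (Set.Icc 0 (k : ℝ≥0))ᶜ ≤ v k} := by
    intro n
    refine ⟨?_, fun k => ?_⟩
    · rw [← ENNReal.coe_le_coe, FiniteMeasure.ennreal_mass]
      exact hmass n
    · rw [← ENNReal.coe_le_coe, FiniteMeasure.ennreal_coeFn_eq_coeFn_toMeasure]
      change refMeasure (F (s n)) (Set.Icc 0 (k : ℝ≥0))ᶜ ≤ _
      have hS : MeasurableSet (Set.Icc 0 (k : ℝ≥0))ᶜ := measurableSet_Icc.compl
      rw [← lintegral_indicator_one hS,
        lintegral_refMeasure (hF.measurable _) (measurable_one.indicator hS)]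
      have hm := hF.measurable (s n)
      calc _ ≤ ∫⁻ x, ENNReal.ofReal (Real.exp (-((k : ℝ) ^ 2 / 4))) *
            (refFun 2 x * F (s n) x) ∂leb := by
            refine lintegral_mono fun x => ?_
            by_cases hx : toNNReal x ∈ (Set.Icc 0 (k : ℝ≥0))ᶜ
            · rw [Set.indicator_of_mem hx, Pi.one_apply, mul_one, ← mul_assoc]
              gcongr
              refine refFun_one_le (by positivity) ?_
              have : (k : ℝ≥0) < toNNReal x := by simpa using hx
              exact this.le
            · rw [Set.indicator_of_notMem hx, mul_zero]
              exact zero_le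
        _ ≤ _ := by
            rw [lintegral_const_mul _ (by fun_prop), hv, ENNReal.coe_mul]
            gcongr
            · exact le_rfl
            · exact hC₂ _ (hs n)
  obtain ⟨η, -, hη⟩ := hcompact.ultrafilter_le_nhds ((hyperfilter ℕ).map ν)
    (by
      rw [le_principal_iff]
      exact mem_map.2 (Eventually.of_forall hmem))
  refine ⟨η, inferInstance, fun f => ?_⟩
  exact FiniteMeasure.tendsto_iff_forall_lintegral_tendsto.1
    (show Tendsto ν (hyperfilter ℕ) (𝓝 η) from hη) f

/-! ### Passage to the limit and the correspondence -/

/-- The quotient of `p_t(x, y) / (2 g₁(t, y))` by `x e^{-x²/2}`, continuously extended to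
`x = 0`. -/
def ratio (t y x : ℝ) : ℝ :=
  Real.exp (-((2 * t)⁻¹ - 2⁻¹) * x ^ 2) * dslope (fun x => Real.sinh (y / t * x)) 0 x

theorem continuous_ratio (t y : ℝ) : Continuous (ratio t y) := by
  have h : Continuous (dslope (fun x => Real.sinh (y / t * x)) 0) := by
    refine continuous_iff_continuousAt.2 fun x => ?_
    rcases eq_or_ne x 0 with rfl | hx
    · exact continuousAt_dslope_same.2 (by fun_prop)
    · exact (continuousAt_dslope_of_ne hx).2 (by fun_prop)
  unfold ratio
  fun_prop

theorem ratio_zero (t y : ℝ) : ratio t y 0 = y / t := by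
  have h : HasDerivAt (fun x => Real.sinh (y / t * x)) (y / t) 0 := by
    have h1 := ((hasDerivAt_id (0 : ℝ)).const_mul (y / t)).sinh
    simpa using h1
  unfold ratio
  rw [dslope_same, h.deriv]
  simp

theorem ratio_of_ne_zero (t y : ℝ) {x : ℝ} (hx : x ≠ 0) : ratio t y x =
    Real.exp (-((2 * t)⁻¹ - 2⁻¹) * x ^ 2) * (Real.sinh (y / t * x) / x) := by
  unfold ratio
  rw [dslope_of_ne _ hx, slope_def_field]
  simp

theorem ratio_nonneg {t y x : ℝ} (ht : 0 < t) (hy : 0 < y) (hx : 0 ≤ x) : 0 ≤ ratio t y x := by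
  rcases hx.eq_or_lt with rfl | hx
  · rw [ratio_zero]; positivity
  · rw [ratio_of_ne_zero t y hx.ne']
    have := (Real.sinh_pos_iff.2 (show 0 < y / t * x by positivity)).le
    positivity

theorem sinh_le_self_mul_exp (v : ℝ) : Real.sinh v ≤ v * Real.exp v := by
  have h1 := Real.add_one_le_exp (-(2 * v))
  have h2 : Real.exp (-v) = Real.exp v * Real.exp (-(2 * v)) := by
    rw [← Real.exp_add]; congr 1; ring
  rw [Real.sinh_eq, h2]
  nlinarith [Real.exp_pos v]

/-- The ratio is bounded as long as the time is smaller than the time `1` of the reference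
function. -/
theorem exists_ratio_le {t y : ℝ} (ht : 0 < t) (ht1 : t < 1) (hy : 0 < y) :
    ∃ M, ∀ x, 0 ≤ x → ratio t y x ≤ M := by
  set δ := (2 * t)⁻¹ - 2⁻¹ with hδ
  have hδ0 : 0 < δ := by
    rw [hδ, sub_pos]
    exact inv_strictAnti₀ (by positivity) (by linarith)
  set b := y / t with hb
  have hb0 : 0 < b := by positivity
  have hle : ∀ x : ℝ, 0 < x → ratio t y x ≤ b * Real.exp (b ^ 2 / (4 * δ)) := by
    intro x hx
    rw [ratio_of_ne_zero t y hx.ne', ← hδ, ← hb]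
    have h1 : Real.sinh (b * x) / x ≤ b * Real.exp (b * x) := by
      rw [div_le_iff₀ hx]
      exact (sinh_le_self_mul_exp (b * x)).trans_eq (by ring)
    have h2 : Real.exp (-δ * x ^ 2) * Real.exp (b * x) ≤ Real.exp (b ^ 2 / (4 * δ)) := by
      rw [← Real.exp_add]
      refine Real.exp_le_exp.2 ?_
      rw [le_div_iff₀ (by positivity)]
      nlinarith [sq_nonneg (2 * δ * x - b)]
    calc _ ≤ Real.exp (-δ * x ^ 2) * (b * Real.exp (b * x)) := by gcongr
      _ = b * (Real.exp (-δ * x ^ 2) * Real.exp (b * x)) := by ring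
      _ ≤ _ := by gcongr
  refine ⟨max (b * Real.exp (b ^ 2 / (4 * δ))) (y / t), fun x hx => ?_⟩
  rcases hx.eq_or_lt with rfl | hx
  · rw [ratio_zero]; exact le_max_right _ _
  · exact (hle x hx).trans (le_max_left _ _)

theorem kernel_eq_ratio {t : ℝ} (ht : 0 < t) (x y : HalfLine) : kernel t x y =
    ENNReal.ofReal (2 * heatKernel t y) * (refFun 1 x * ENNReal.ofReal (ratio t y x)) := by
  have hx := x.2
  have hg := heatKernel_pos ht (y : ℝ)
  unfold kernel refFun
  rw [← ENNReal.ofReal_mul (by positivity), ← ENNReal.ofReal_mul (by positivity),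
    transitionDensity_eq_sinh ht, ratio_of_ne_zero t y hx.ne']
  congr 2
  have h : Real.exp (-(x : ℝ) ^ 2 / (2 * t)) = Real.exp (-(x : ℝ) ^ 2 / (2 * 1)) *
      Real.exp (-((2 * t)⁻¹ - 2⁻¹) * (x : ℝ) ^ 2) := by
    rw [← Real.exp_add]
    congr 1
    field_simp
    ring
  rw [h]
  field_simp

/-- The ratio as a bounded continuous test function on `[0, ∞)`. -/
theorem exists_boundedContinuous_ratio {t y : ℝ} (ht : 0 < t) (ht1 : t < 1) (hy : 0 < y) :
    ∃ f : BoundedContinuousFunction ℝ≥0 ℝ≥0,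
      ∀ x, (f x : ℝ≥0∞) = ENNReal.ofReal (ratio t y x) := by
  obtain ⟨M, hM⟩ := exists_ratio_le ht ht1 hy
  have hc : Continuous fun x : ℝ≥0 => (ratio t y x).toNNReal :=
    continuous_real_toNNReal.comp ((continuous_ratio t y).comp NNReal.continuous_coe)
  refine ⟨BoundedContinuousFunction.mkOfBound ⟨_, hc⟩ M fun x x' => ?_, fun x => rfl⟩
  have hx := x.coe_nonneg
  have hx' := x'.coe_nonneg
  have h1 := ratio_nonneg ht hy hx
  have h2 := ratio_nonneg ht hy hx'
  rw [NNReal.dist_eq]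
  simp only [ContinuousMap.coe_mk]
  rw [Real.coe_toNNReal _ h1, Real.coe_toNNReal _ h2]
  exact abs_sub_le_of_nonneg_of_le h1 (hM x hx) h2 (hM x' hx')

/-- A measurable left inverse of the inclusion of `(0, ∞)` into `[0, ∞)`. -/
def ofNNReal (x : ℝ≥0) : HalfLine :=
  ⟨if 0 < x then (x : ℝ) else 1, by split_ifs with h; exacts [h, one_pos]⟩

@[fun_prop]
theorem measurable_ofNNReal : Measurable ofNNReal :=
  (Measurable.ite measurableSet_Ioi measurable_coe_nnreal_real measurable_const).subtype_mk

theorem coe_ofNNReal {x : ℝ≥0} (hx : 0 < x) : (ofNNReal x : ℝ) = x := if_pos hx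

/-- The representing measure: the part on `(0, ∞)` of a limit measure `η` on `[0, ∞)`, divided by
the reference function. -/
def limitMeasure (η : Measure ℝ≥0) : Measure HalfLine :=
  ((η.restrict (Set.Ioi 0)).map ofNNReal).withDensity fun x => (refFun 1 x)⁻¹

instance (η : Measure ℝ≥0) [IsFiniteMeasure η] : SFinite (limitMeasure η) := by
  unfold limitMeasure; infer_instance

/-- Integrating the ratio against `η` gives an entrance law: the atom of `η` at `0` produces the
boundary kernel. -/
theorem mul_lintegral_ratio_eq_entranceLaw (η : Measure ℝ≥0) {t : ℝ} (ht : 0 < t) (y : HalfLine) :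
    ENNReal.ofReal (2 * heatKernel t y) * ∫⁻ x : ℝ≥0, ENNReal.ofReal (ratio t y x) ∂η =
      entranceLaw (2 * η {0}) (limitMeasure η) t y := by
  have hy := y.2
  have hg := heatKernel_pos ht (y : ℝ)
  have hm : Measurable fun x : ℝ => ENNReal.ofReal (ratio t y x) :=
    (continuous_ratio t y).measurable.ennreal_ofReal
  have hsplit : ∫⁻ x : ℝ≥0, ENNReal.ofReal (ratio t y x) ∂η =
      ENNReal.ofReal (y / t) * η {0} +
        ∫⁻ x : ℝ≥0 in Set.Ioi 0, ENNReal.ofReal (ratio t y x) ∂η := by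
    have hc : (Set.Ioi 0 : Set ℝ≥0) = {0}ᶜ := by
      ext x; simp [pos_iff_ne_zero]
    rw [hc, ← lintegral_add_compl _ (measurableSet_singleton (0 : ℝ≥0)), lintegral_singleton,
      NNReal.coe_zero, ratio_zero]
  have hpot : potential (limitMeasure η) t y = ENNReal.ofReal (2 * heatKernel t y) *
      ∫⁻ x : ℝ≥0 in Set.Ioi 0, ENNReal.ofReal (ratio t y x) ∂η := by
    unfold potential limitMeasure
    rw [lintegral_withDensity_eq_lintegral_mul _ (by fun_prop) (by fun_prop)]
    have e : ∀ z : HalfLine, ((fun x => (refFun 1 x)⁻¹) * fun z => kernel t z y) z =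
        ENNReal.ofReal (2 * heatKernel t y) * ENNReal.ofReal (ratio t y z) := fun z => by
      simp only [Pi.mul_apply]
      rw [kernel_eq_ratio ht]
      have hi := ENNReal.inv_mul_cancel (refFun_ne_zero 1 z) (refFun_ne_top 1 z)
      calc _ = ((refFun 1 z)⁻¹ * refFun 1 z) *
          (ENNReal.ofReal (2 * heatKernel t y) * ENNReal.ofReal (ratio t y z)) := by ring
        _ = _ := by rw [hi, one_mul]
    simp only [e]
    have hm' : Measurable fun z : HalfLine => ENNReal.ofReal (ratio t y z) :=
      hm.comp measurable_subtype_coe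
    rw [lintegral_const_mul _ hm', lintegral_map hm' measurable_ofNNReal]
    congr 1
    refine setLIntegral_congr_fun measurableSet_Ioi fun x hx => ?_
    simp only [coe_ofNNReal hx]
  unfold entranceLaw
  rw [hsplit, hpot, mul_add]
  congr 1
  have hb : boundaryFun t y = ENNReal.ofReal (heatKernel t y) * ENNReal.ofReal (y / t) := by
    unfold boundaryFun boundaryKernel
    rw [← ENNReal.ofReal_mul hg.le]
    congr 1
    ring
  rw [hb, ENNReal.ofReal_mul zero_le_two, ENNReal.ofReal_ofNat]
  ring

/-- The representation at times before `1`, by passing to the limit `s → 0` in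
`T_t F_s(y) = ∫ p_t(x, y) F_s(x) dx`. -/
theorem IsEntranceLaw.exists_ae_eq_of_lt_one {F : HalfLine → HalfLine → ℝ≥0∞}
    (hF : IsEntranceLaw F) :
    ∃ (a : ℝ) (μ : Measure HalfLine), 0 ≤ a ∧ SFinite μ ∧ ∀ t : HalfLine, (t : ℝ) < 1 →
      (∀ y, entranceLaw (ENNReal.ofReal a) μ t y ≠ ⊤) ∧
        F t =ᵐ[leb] entranceLaw (ENNReal.ofReal a) μ t := by
  set s : ℕ → HalfLine := fun n => ⟨1 / ((n : ℝ) + 1), Nat.one_div_pos_of_nat⟩ with hs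
  have hs1 : ∀ n, (s n : ℝ) ≤ 1 := fun n => by
    have : (0 : ℝ) ≤ n := n.cast_nonneg
    exact (div_le_one (by positivity)).2 (by linarith)
  obtain ⟨η, hη, hlim⟩ := hF.exists_limit hs1
  refine ⟨(2 * η {0}).toReal, limitMeasure η, ENNReal.toReal_nonneg, inferInstance,
    fun t ht1 => ?_⟩
  rw [ENNReal.ofReal_toReal (ENNReal.mul_ne_top (by norm_num) (measure_ne_top η _))]
  set h : HalfLine := ⟨t / 2, half_pos t.2⟩ with hh
  have hht : h + h = t := Subtype.ext (add_halves (t : ℝ))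
  have key : ∀ y, heatOp h (F h) y = entranceLaw (2 * η {0}) (limitMeasure η) t y := by
    intro y
    obtain ⟨f, hf⟩ := exists_boundedContinuous_ratio t.2 ht1 y.2
    rw [← mul_lintegral_ratio_eq_entranceLaw η t.2]
    simp only [← hf]
    have h1 : Tendsto (fun n => heatOp (h + s n : HalfLine) (F h) y) (hyperfilter ℕ)
        (𝓝 (heatOp h (F h) y)) := by
      refine (tendsto_heatOp_add h.2 (hF.measurable h) (fun n => (s n).2) hs1
        tendsto_one_div_add_atTop_nhds_zero_nat ?_).mono_left Nat.hyperfilter_le_atTop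
      exact hF.heatOp_ne_top h (h + ⟨1, one_pos⟩) y
    have h2 := ENNReal.Tendsto.const_mul (a := ENNReal.ofReal (2 * heatKernel t y)) (hlim f)
      (Or.inr ENNReal.ofReal_ne_top)
    refine tendsto_nhds_unique h1 (h2.congr fun n => ?_)
    have hsum : s n + t = h + (h + s n) := by rw [← add_assoc, hht, add_comm]
    rw [← hF.heatOp_eq_heatOp hsum]
    have hm := hF.measurable (s n)
    have hfm : Measurable fun x => (f x : ℝ≥0∞) := f.continuous.measurable.coe_nnreal_ennreal
    rw [lintegral_refMeasure hm hfm, ← lintegral_const_mul _ (by fun_prop)]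
    refine lintegral_congr fun x => ?_
    rw [kernel_symm, kernel_eq_ratio t.2, hf]
    change ENNReal.ofReal (2 * heatKernel t y) *
      (refFun 1 x * F (s n) x * ENNReal.ofReal (ratio t y x)) = _
    ring
  refine ⟨fun y => ?_, ?_⟩
  · rw [← key]
    exact hF.heatOp_ne_top h h y
  · rw [← funext key]
    have := hF.ae_eq h h
    rwa [hht] at this

theorem isEntranceLaw_ofReal {u : HalfLine → H} (hu : ∀ s, 0 ≤ u s) (h : IsEntrancePath u) :
    IsEntranceLaw fun s y => ENNReal.ofReal (u s y) where
  measurable r := (Lp.stronglyMeasurable (u r)).measurable.ennreal_ofReal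
  ae_eq := (isEntrancePath_iff hu).1 h
  heatOp_ne_top r t x := by
    rw [← ofReal_semigroup t (hu r)]
    exact ENNReal.ofReal_ne_top

/-- Every element of the non-negative entrance space is represented by some pair `(a, μ)`. -/
theorem exists_represents_of_mem {u : HalfLine → H} (hu : u ∈ nonnegEntranceSpace) :
    ∃ a : ℝ, 0 ≤ a ∧ ∃ μ ∈ entranceMeasures, Represents u a μ := by
  obtain ⟨⟨hpath, l, hl⟩, hu0⟩ := hu
  have hF := isEntranceLaw_ofReal hu0 hpath
  obtain ⟨a, μ, ha, hμ, hrep⟩ := hF.exists_ae_eq_of_lt_one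
  set h : HalfLine := ⟨1 / 2, by norm_num⟩ with hh
  have hμS : μ ∈ entranceMeasures := by
    refine mem_entranceMeasures.2 ⟨min l h, lt_of_le_of_lt ?_ hl⟩
    refine (setLIntegral_mono' measurableSet_Iio fun s hs => ?_).trans
      (lintegral_mono_set (Set.Iio_subset_Iio (min_le_left l h)))
    have hs1 : (s : ℝ) < 1 := by
      have : (s : ℝ) < 1 / 2 := hs.trans_le (min_le_right l h)
      linarith
    rw [enorm_sq_eq_lintegral (hu0 s)]
    refine lintegral_mono_ae ?_
    filter_upwards [gam_absolutelyContinuous_leb.ae_le (hrep s hs1).2] with y hy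
    rw [hy]
    gcongr
    exact le_add_self
  refine ⟨a, ha, μ, hμS, ?_⟩
  rw [represents_iff hu0 ha]
  refine fun s => ⟨(potential_of_mem_entranceMeasures hμS s).2,
    gam_absolutelyContinuous_leb.ae_le ?_⟩
  rcases lt_or_ge (s : ℝ) 1 with hs | hs
  · exact (hrep s hs).2
  · have hd : (0 : ℝ) < s - 1 / 2 := by linarith
    have hsum : h + ⟨s - 1 / 2, hd⟩ = s := Subtype.ext (add_sub_cancel _ _)
    have h1 := hF.ae_eq h ⟨s - 1 / 2, hd⟩
    rw [hsum, heatOp_congr (hrep h (by norm_num [hh])).2, heatOp_entranceLaw h.2 hd] at h1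
    have h2 : (s : ℝ) - 1 / 2 + h = s := sub_add_cancel _ _
    rwa [h2] at h1

end AbsorbingBM

end

theorem theorem5p2 :
    ∃ Φ : AbsorbingBM.nonnegEntranceSpace ≃
        Set.Ici (0 : ℝ) ×ˢ AbsorbingBM.entranceMeasures,
      ∀ (u : AbsorbingBM.nonnegEntranceSpace)
        (p : Set.Ici (0 : ℝ) ×ˢ AbsorbingBM.entranceMeasures),
        Φ u = p ↔ AbsorbingBM.Represents u.1 p.1.1 p.1.2 := by
  have hex : ∀ u : AbsorbingBM.nonnegEntranceSpace,
      ∃ p : Set.Ici (0 : ℝ) ×ˢ AbsorbingBM.entranceMeasures,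
        AbsorbingBM.Represents u.1 p.1.1 p.1.2 := fun u => by
    obtain ⟨a, ha, μ, hμ, h⟩ := AbsorbingBM.exists_represents_of_mem u.2
    exact ⟨⟨(a, μ), ha, hμ⟩, h⟩
  have huniq : ∀ (u : AbsorbingBM.nonnegEntranceSpace)
      (p q : Set.Ici (0 : ℝ) ×ˢ AbsorbingBM.entranceMeasures),
      AbsorbingBM.Represents u.1 p.1.1 p.1.2 → AbsorbingBM.Represents u.1 q.1.1 q.1.2 →
        p = q := fun u p q hp hq => by
    obtain ⟨h1, h2⟩ := AbsorbingBM.represents_unique u.2.2 p.2.1 q.2.1 hp hq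
    exact Subtype.ext (Prod.ext h1 h2)
  choose φ hφ using hex
  have hbij : Function.Bijective φ := by
    refine ⟨fun u v huv => ?_, fun p => ?_⟩
    · have hu := hφ u
      rw [huv] at hu
      refine Subtype.ext (funext fun s => Lp.ext ?_)
      exact (hu s).2.trans (hφ v s).2.symm
    · obtain ⟨u, hu, hrep⟩ := AbsorbingBM.exists_represents p.2.1 p.2.2
      exact ⟨⟨u, hu⟩, huniq _ _ _ (hφ ⟨u, hu⟩) hrep⟩
  refine ⟨Equiv.ofBijective φ hbij, fun u p => ⟨?_, fun h => huniq u _ _ (hφ u) h⟩⟩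
  rintro rfl
  exact hφ u
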